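/- **Setting.** Let $\mathcal X\subset\mathbb R^n$ and $\mathcal Y\subset\mathbb R^m$ be convex and compact, with $d=\max\{n,m\}$ and $D=\max\{\operatorname{diam}\mathcal X,\operatorname{diam}\mathcal Y\}$. Let $f(x,y)=\mathbb E_{\xi\sim\mathcal D}[F(x,y;\xi)]$ be continuously differentiable in $x$ and in $y$ and convex-concave on $\mathcal X\times\mathcal Y$, and let $(x^*,y^*)\in\mathcal X\times\mathcal Y$ be a saddle point: $f(x^*,y)\le f(x^*,y^*)\le f(x,y^*)$ for all $x\in\mathcal X$, $y\in\mathcal Y$. Suppose that for some $L>0$ both $\nabla_xf$ and $\nabla_yf$ satisfy $\|\nabla f(x_1,y_1)-\nabla f(x_2,y_2)\|\le L(\|x_1-x_2\|+\|y_1-y_2\|)$ on $\mathcal X\times\mathcal Y$. Let $g_x(x,y;\xi)$, $g_y(x,y;\xi)$ with $\xi\sim\mathcal D$ be, at every $(x,y)\in\mathcal X\times\mathcal Y$, unbiased estimates of $\nabla_xf(x,y)$, $\nabla_yf(x,y)$ whose components have variances at most $\sigma_x^2(j)$ ($j\le n$) and $\sigma_y^2(k)$ ($k\le m$). Put $\sigma=\max\{(\sum_j\sigma_x^2(j))^{1/2},(\sum_k\sigma_y^2(k))^{1/2}\}$.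 **Trimmed mean.** Let $M$ be even. Given real numbers $Z_1,\dots,Z_{M/2},\tilde Z_1,\dots,\tilde Z_{M/2}$, $\alpha\ge0$ and $\delta>0$, let $\epsilon=8\alpha+24\log(4/\delta)/M$. Let $Z^*_1\le\dots\le Z^*_{M/2}$ be the ordered $Z_i$, and let $\gamma=Z^*_{\lceil\epsilon M/2\rceil}$ and $\beta=Z^*_{\lceil(1-\epsilon)M/2\rceil}$. The output is $\frac2M\sum_i\phi_{\gamma,\beta}(\tilde Z_i)$, where $\phi_{\gamma,\beta}$ truncates a number to $[\gamma,\beta]$. $\mathtt{Trim}$ applies this to $M$ vectors coordinate by coordinate. **Algorithm (RDEG).** There are $M$ agents, and a fixed set $\mathcal B$ of at most $\alpha M$ of them is Byzantine. Start from $x_1\in\mathcal X$, $y_1\in\mathcal Y$. In round $t=1,\dots,T$ there are two communication phases, first at $(x_t,y_t)$ and then at the mid-point $(\hat x_t,\hat y_t)$. In a phase at a point $(x,y)$ each normal agent draws a fresh sample $\xi\sim\mathcal D$, independent of the other normal agents' samples and of the past, and sends $g_x(x,y;\xi)$, $g_y(x,y;\xi)$. Byzantine agents send arbitrary vectors, which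 may depend on the whole past, on private randomness and on the normal agents' samples of the current phase, but not on samples that are still to be drawn. The server forms $\tilde g_x(x,y)$, $\tilde g_y(x,y)$ by applying $\mathtt{Trim}$ to the $M$ messages. The updates are $$\hat x_t=\Pi_{\mathcal X}(x_t-\eta\tilde g_x(x_t,y_t)),\quad \hat y_t=\Pi_{\mathcal Y}(y_t+\eta\tilde g_y(x_t,y_t)),$$ $$x_{t+1}=\Pi_{\mathcal X}(x_t-\eta\tilde g_x(\hat x_t,\hat y_t)),\quad y_{t+1}=\Pi_{\mathcal Y}(y_t+\eta\tilde g_y(\hat x_t,\hat y_t)),$$ with $\Pi$ the Euclidean projection. Let $\bar x_T=\frac1T\sum_{t=1}^T\hat x_t$ and $\bar y_T=\frac1T\sum_{t=1}^T\hat y_t$. **Corollary.** There is a universal constant $C>0$ such that in every such setting the following holds. If $T\ge1$, $0\le\alpha<1/16$, $M\ge48\log(16dT^2)$, $\delta=1/(4dT^2)$, $0<\eta\le1/(2L)$, and the resulting trimming level satisfies $\epsilon=8\alpha+24\log(16dT^2)/M\le1/2$ (so that the lower trimming quantile $\gamma$ does not exceed the upper one $\beta$), then with probability at least $1-1/T$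 $$|f(\bar x_T,\bar y_T)-f(x^*,y^*)|\le\frac{D^2}{\eta T}+C\,\sigma D\left(\sqrt\alpha+\sqrt{\frac{\log(4dT^2)}{M}}\right).$$ In particular the left side is at most $\frac{D^2}{\eta T}+\tilde O\big(\sigma D(\sqrt\alpha+\sqrt{1/M})\big)$, where $\tilde O$ hides factors logarithmic in $n,m,T$. -/

import Mathlib

open MeasureTheory ProbabilityTheory

universe u v

/-- Euclidean space of dimension `n`. -/
abbrev Vec (n : ℕ) : Type := EuclideanSpace ℝ (Fin n)

/-- The population function `f(x, y) = 𝔼_{s ∼ 𝒟} [F(x, y; s)]`. -/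
noncomputable def population {n m : ℕ} {Ξ : Type u} [MeasurableSpace Ξ] (𝒟 : Measure Ξ)
    (F : Vec n → Vec m → Ξ → ℝ) (x : Vec n) (y : Vec m) : ℝ :=
  ∫ s, F x y s ∂𝒟

/-- `Gx`, `Gy` are the partial gradients of `f` at the points of `X × Y`, and they are continuous
there. Derivatives are taken within the feasible sets, so that nothing is asked of `f` outside
`X × Y`; the partial gradients of a function that is continuously differentiable around `X × Y`
qualify. -/
structure IsPartialGradient {n m : ℕ} (X : Set (Vec n)) (Y : Set (Vec m))
    (f : Vec n → Vec m → ℝ) (Gx : Vec n → Vec m → Vec n) (Gy : Vec n → Vec m → Vec m) : Prop where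
  grad_x : ∀ x ∈ X, ∀ y ∈ Y, HasGradientWithinAt (fun x' => f x' y) (Gx x y) X x
  grad_y : ∀ x ∈ X, ∀ y ∈ Y, HasGradientWithinAt (fun y' => f x y') (Gy x y) Y y
  continuous_x : ContinuousOn (fun p : Vec n × Vec m => Gx p.1 p.2) (X ×ˢ Y)
  continuous_y : ContinuousOn (fun p : Vec n × Vec m => Gy p.1 p.2) (X ×ˢ Y)

/-- `f` is convex in its first argument and concave in its second argument over `X × Y`. -/
def IsConvexConcave {n m : ℕ} (X : Set (Vec n)) (Y : Set (Vec m)) (f : Vec n → Vec m → ℝ) : Prop :=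
  (∀ y ∈ Y, ConvexOn ℝ X (fun x => f x y)) ∧ (∀ x ∈ X, ConcaveOn ℝ Y (fun y => f x y))

/-- `L`-smoothness: both partial gradients are `L`-Lipschitz over `X × Y`. -/
def IsSmooth {n m : ℕ} (X : Set (Vec n)) (Y : Set (Vec m)) (L : ℝ)
    (Gx : Vec n → Vec m → Vec n) (Gy : Vec n → Vec m → Vec m) : Prop :=
  ∀ x₁ ∈ X, ∀ x₂ ∈ X, ∀ y₁ ∈ Y, ∀ y₂ ∈ Y,
    ‖Gx x₁ y₁ - Gx x₂ y₂‖ ≤ L * (‖x₁ - x₂‖ + ‖y₁ - y₂‖) ∧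
    ‖Gy x₁ y₁ - Gy x₂ y₂‖ ≤ L * (‖x₁ - x₂‖ + ‖y₁ - y₂‖)

/-- `(xs, ys)` is a saddle point of `f` over `X × Y`. -/
def IsSaddlePoint {n m : ℕ} (X : Set (Vec n)) (Y : Set (Vec m)) (f : Vec n → Vec m → ℝ)
    (xs : Vec n) (ys : Vec m) : Prop :=
  xs ∈ X ∧ ys ∈ Y ∧ ∀ x ∈ X, ∀ y ∈ Y, f xs y ≤ f xs ys ∧ f xs ys ≤ f x ys

/-- The stochastic oracle: unbiased estimates of the partial gradients with component-wise
bounded variances `σx j ^ 2`, `σy k ^ 2`. -/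
structure IsOracle {n m : ℕ} {Ξ : Type u} [MeasurableSpace Ξ] (𝒟 : Measure Ξ)
    (X : Set (Vec n)) (Y : Set (Vec m))
    (Gx : Vec n → Vec m → Vec n) (Gy : Vec n → Vec m → Vec m)
    (gx : Vec n → Vec m → Ξ → Vec n) (gy : Vec n → Vec m → Ξ → Vec m)
    (σx : Fin n → ℝ) (σy : Fin m → ℝ) : Prop where
  measurable_x : Measurable (fun p : (Vec n × Vec m) × Ξ => gx p.1.1 p.1.2 p.2)
  measurable_y : Measurable (fun p : (Vec n × Vec m) × Ξ => gy p.1.1 p.1.2 p.2)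
  memLp_x : ∀ x ∈ X, ∀ y ∈ Y, MemLp (fun s => gx x y s) 2 𝒟
  memLp_y : ∀ x ∈ X, ∀ y ∈ Y, MemLp (fun s => gy x y s) 2 𝒟
  mean_x : ∀ x ∈ X, ∀ y ∈ Y, ∫ s, gx x y s ∂𝒟 = Gx x y
  mean_y : ∀ x ∈ X, ∀ y ∈ Y, ∫ s, gy x y s ∂𝒟 = Gy x y
  var_x : ∀ x ∈ X, ∀ y ∈ Y, ∀ j, ∫ s, (gx x y s j - Gx x y j) ^ 2 ∂𝒟 ≤ σx j ^ 2
  var_y : ∀ x ∈ X, ∀ y ∈ Y, ∀ k, ∫ s, (gy x y s k - Gy x y k) ^ 2 ∂𝒟 ≤ σy k ^ 2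

/-- The total noise level `σ = max {(∑ⱼ σx(j)²)^(1/2), (∑ₖ σy(k)²)^(1/2)}`. -/
noncomputable def noiseLevel {n m : ℕ} (σx : Fin n → ℝ) (σy : Fin m → ℝ) : ℝ :=
  max (Real.sqrt (∑ j, σx j ^ 2)) (Real.sqrt (∑ k, σy k ^ 2))

/-! ### The trimmed-mean estimator -/

/-- The `k`-th smallest entry (`1 ≤ k ≤ N`) of `z`, that is, the `k`-th entry of the
non-decreasing arrangement of `z`. -/
noncomputable def orderStat {N : ℕ} (z : Fin N → ℝ) (k : ℕ) : ℝ :=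
  if h : k - 1 < N then z (Tuple.sort z ⟨k - 1, h⟩) else 0

/-- The truncation function `φ_{γ, β}`. -/
noncomputable def truncate (γ β x : ℝ) : ℝ :=
  if β < x then β else if x < γ then γ else x

/-- The trimming level `ε = 8 α + 24 log(4 / δ) / M`. -/
noncomputable def trimLevel (α δ : ℝ) (M : ℕ) : ℝ :=
  8 * α + 24 * (Real.log (4 / δ) / M)

/-- The univariate trimmed mean of `M` numbers, `M` even: the first half of the data gives the
empirical quantiles `γ`, `β` of levels `ε` and `1 - ε`, the second half is truncated to `[γ, β]`
and averaged. A fractional rank is rounded up, as usual for empirical quantiles. -/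
noncomputable def trimmedMean {M : ℕ} (α δ : ℝ) (z : Fin M → ℝ) : ℝ :=
  let ε := trimLevel α δ M
  let Z : Fin (M / 2) → ℝ := fun i => z ⟨i.1, by omega⟩
  let Z' : Fin (M / 2) → ℝ := fun i => z ⟨M / 2 + i.1, by omega⟩
  let γ := orderStat Z ⌈ε * M / 2⌉₊
  let β := orderStat Z ⌈(1 - ε) * M / 2⌉₊
  2 / (M : ℝ) * ∑ i, truncate γ β (Z' i)

/-- The `Trim` operator: the trimmed mean of `M` vectors, coordinate by coordinate. -/
noncomputable def trim {n M : ℕ} (α δ : ℝ) (z : Fin M → Vec n) : Vec n :=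
  WithLp.toLp 2 (fun j => trimmedMean α δ (fun i => z i j))

/-! ### Robust distributed extra-gradient -/

/-- Euclidean projection: a point of `X` nearest to `v` (the unique one if `X` is nonempty, closed
and convex). -/
noncomputable def euclProj {n : ℕ} (X : Set (Vec n)) (v : Vec n) : Vec n :=
  Classical.epsilon (fun p => p ∈ X ∧ ∀ q ∈ X, ‖p - v‖ ≤ ‖q - v‖)

/-- The data of a run of the algorithm with `M` agents: the feasible sets, the oracle of the normal
agents, the set `B` of Byzantine agents, the parameters `α`, `δ` of the trimmed mean, the step-size
`η`, and the initial vectors. -/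
structure RDEG (n m M : ℕ) (Ξ : Type u) where
  X : Set (Vec n)
  Y : Set (Vec m)
  gx : Vec n → Vec m → Ξ → Vec n
  gy : Vec n → Vec m → Ξ → Vec m
  B : Finset (Fin M)
  α : ℝ
  δ : ℝ
  η : ℝ
  x₁ : Vec n
  y₁ : Vec m

namespace RDEG

variable {n m M : ℕ} {Ξ : Type u} (S : RDEG n m M Ξ)

/-- Projected primal-dual step from `z` along `(hx, hy)`. -/
noncomputable def step (z : Vec n × Vec m) (hx : Vec n) (hy : Vec m) : Vec n × Vec m :=
  (euclProj S.X (z.1 - S.η • hx), euclProj S.Y (z.2 + S.η • hy))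

/-- The robust gradient with respect to `x` at the point `w`: normal agent `i` sends the oracle's
answer for its sample `s i`, Byzantine agent `i` sends the vector `a i`. -/
noncomputable def robustX (w : Vec n × Vec m) (s : Fin M → Ξ) (a : Fin M → Vec n) : Vec n :=
  trim S.α S.δ (fun i => if i ∈ S.B then a i else S.gx w.1 w.2 (s i))

/-- The robust gradient with respect to `y` at the point `w`. -/
noncomputable def robustY (w : Vec n × Vec m) (s : Fin M → Ξ) (a : Fin M → Vec m) : Vec m :=
  trim S.α S.δ (fun i => if i ∈ S.B then a i else S.gy w.1 w.2 (s i))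

/-- The mid-point of a round that starts at `z`. -/
noncomputable def mid (z : Vec n × Vec m) (s : Fin M → Ξ) (ax : Fin M → Vec n)
    (ay : Fin M → Vec m) : Vec n × Vec m :=
  S.step z (S.robustX z s ax) (S.robustY z s ay)

/-- The iterates; `S.iter s ax ay t` is the pair with which the round of index `t` starts, rounds
being counted from `0`. The round of index `t` consists of the two communication phases
`2 * t` (at the iterate) and `2 * t + 1` (at the mid-point); in phase `k` the samples of the normal
agents are `s k` and the messages of the Byzantine agents are `ax k`, `ay k`. -/
noncomputable def iter (s : ℕ → Fin M → Ξ) (ax : ℕ → Fin M → Vec n) (ay : ℕ → Fin M → Vec m) :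
    ℕ → Vec n × Vec m
  | 0 => (S.x₁, S.y₁)
  | t + 1 =>
    let z := iter s ax ay t
    let w := S.mid z (s (2 * t)) (ax (2 * t)) (ay (2 * t))
    S.step z (S.robustX w (s (2 * t + 1)) (ax (2 * t + 1)))
      (S.robustY w (s (2 * t + 1)) (ay (2 * t + 1)))

/-- The mid-point computed in the round of index `t`. -/
noncomputable def midIter (s : ℕ → Fin M → Ξ) (ax : ℕ → Fin M → Vec n) (ay : ℕ → Fin M → Vec m)
    (t : ℕ) : Vec n × Vec m :=
  S.mid (S.iter s ax ay t) (s (2 * t)) (ax (2 * t)) (ay (2 * t))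

/-- The average `(1 / T) ∑ₜ` of the mid-points of the first `T` rounds. -/
noncomputable def average (s : ℕ → Fin M → Ξ) (ax : ℕ → Fin M → Vec n) (ay : ℕ → Fin M → Vec m)
    (T : ℕ) : Vec n × Vec m :=
  (1 / (T : ℝ)) • ∑ t ∈ Finset.range T, S.midIter s ax ay t

end RDEG

/-- Sampling and adversary over the phases `k < K`. The σ-algebra `ℱ k` is everything that has
happened before phase `k`. In phase `k` the normal agents draw i.i.d. samples from `𝒟` that are
independent of `ℱ k`. The Byzantine agents may use `ℱ (k + 1)`, that is, the whole past, private
randomness, and even all samples drawn by the normal agents in the current phase; they cannot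
see samples that have not been drawn yet. -/
structure IsByzantineModel {n m M : ℕ} {Ξ : Type u} [MeasurableSpace Ξ] {Ω : Type v}
    [mΩ : MeasurableSpace Ω] (P : Measure Ω) (ℱ : Filtration ℕ mΩ) (𝒟 : Measure Ξ)
    (B : Finset (Fin M)) (K : ℕ) (ξ : ℕ → Fin M → Ω → Ξ)
    (ax : ℕ → Fin M → Ω → Vec n) (ay : ℕ → Fin M → Ω → Vec m) : Prop where
  sample_adapted : ∀ k < K, ∀ i ∉ B, Measurable[ℱ (k + 1)] (ξ k i)
  sample_law : ∀ k < K, ∀ i ∉ B, P.map (ξ k i) = 𝒟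
  sample_indep : ∀ k < K, iIndepFun (fun (i : {i // i ∉ B}) => ξ k i) P
  sample_indep_past : ∀ k < K,
    Indep (⨆ i : {i // i ∉ B}, MeasurableSpace.comap (ξ k i) inferInstance) (ℱ k) P
  message_x : ∀ k < K, ∀ i ∈ B, Measurable[ℱ (k + 1)] (ax k i)
  message_y : ∀ k < K, ∀ i ∈ B, Measurable[ℱ (k + 1)] (ay k i)

/-! The proof separates randomness from optimization. On a good event every robust gradient is
within `e = 68 √ε σ` of the true one, and extra-gradient with gradient errors `e` is then analysed
deterministically.

Trimmed mean of one coordinate: put `N = M / 2`, `a = ε N`, and choose `R` with `σ² = R² ε / 4`, so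
that by Chebyshev a sample exceeds `μ + R` with probability at most `ε / 4`. The event
`UpperRegular`, imposed on `v` and on `-v`, involves only the normal agents' samples. On it,
whatever the at most `a / 4` Byzantine entries are, `γ` and `β` lie in `[μ - R, μ + R]` and
truncation affects at most `16 a` normal entries of the second half. The average of the truncated
values then differs from that of the deviations clipped at `R` by `O(R ε)`, and the latter is itself
at most `R ε` in absolute value (`abs_trimmedMean_sub_le`). Since the messages do not enter the
event, the adversary may see the current samples. Chernoff bounds with exponent 1 show that the
event fails with probability at most `8 exp(-ε N / 4)` (`pi_real_not_upperRegular_le`, applied on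
both sides).

Gradients are queried at random points, but each point is determined by the past and the samples of
the phase are independent of the past, so Fubini reduces to a fixed point
(`measure_not_upperRegular_le`). No covering of `X × Y` is needed. A union bound over coordinates,
the two phases and `T` rounds costs at most `4 d T δ = 1 / T`.

On the good event, the variational inequalities of the projections give one-step progress
(`extragradient_step_le`): smoothness with `η L ≤ 1 / 2` is absorbed by the negative squares, and
the gradient errors cost `6 e D`. Telescoping and convexity-concavity bound `f(x̄, r) - f(q, ȳ)` for
all `q`, `r` at once, and two choices of `(q, r)` give the saddle value. Finally `√ε ≤ 7 (√α +
√(log(4 d T²) / M))`. -/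

/-! ### Order statistics through counting -/

/-- Sorting permutes the positions, so it does not change how many entries are at most `c`.
Expressing ranks by counts makes monotonicity, measurability and robustness to corrupted entries
elementary. -/
lemma orderStat_le_iff {N : ℕ} (z : Fin N → ℝ) {k : ℕ} (hk : 0 < k) (hkN : k ≤ N) (c : ℝ) :
    orderStat z k ≤ c ↔ k ≤ (Finset.univ.filter fun i => z i ≤ c).card := by
  have h : k - 1 < N := by omega
  have hm := Tuple.lt_card_le_iff_apply_le_of_monotone (a := c) (j := ⟨k - 1, h⟩)
    (Tuple.monotone_sort z)
  have hc : (Finset.univ.filter fun i => (z ∘ Tuple.sort z) i ≤ c).card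
      = (Finset.univ.filter fun i => z i ≤ c).card := by
    refine Finset.card_bij (fun i _ => Tuple.sort z i) ?_ ?_ ?_
    · intro a ha; simpa using ha
    · intro a _ b _ hab; exact (Tuple.sort z).injective hab
    · intro b hb; exact ⟨(Tuple.sort z).symm b, by simpa using hb, by simp⟩
  rw [orderStat, dif_pos h]
  rw [← hc]
  simp only [Function.comp_apply] at hm ⊢
  exact hm.symm.trans ⟨fun h => by omega, fun h => by omega⟩

lemma orderStat_mono {N : ℕ} (z : Fin N → ℝ) {k l : ℕ} (hk : 0 < k) (hkl : k ≤ l) (hl : l ≤ N) :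
    orderStat z k ≤ orderStat z l :=
  (orderStat_le_iff z hk (hkl.trans hl) _).2
    (hkl.trans ((orderStat_le_iff z (hk.trans_le hkl) hl _).1 le_rfl))

lemma measurable_orderStat {N : ℕ} (k : ℕ) :
    Measurable (fun z : Fin N → ℝ => orderStat z k) := by
  by_cases hN : k - 1 < N
  -- Natural subtraction gives rank `0` the same entry as rank `1`, so the rank may be taken
  -- positive.
  · have h0 : ∀ z : Fin N → ℝ, orderStat z k = orderStat z (k - 1 + 1) := fun z => by
      simp [orderStat]
    simp_rw [h0]
    refine measurable_of_Iic fun c => ?_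
    have : (fun z : Fin N → ℝ => orderStat z (k - 1 + 1)) ⁻¹' Set.Iic c
        = {z | k - 1 + 1 ≤ (Finset.univ.filter fun i => z i ≤ c).card} := by
      ext z
      simpa using orderStat_le_iff z (Nat.succ_pos (k - 1)) hN c
    rw [this]
    simp_rw [Finset.card_filter]
    refine measurableSet_le measurable_const (Finset.measurable_sum _ fun i _ => ?_)
    exact Measurable.ite (measurableSet_le (measurable_pi_apply i) measurable_const)
      measurable_const measurable_const
  · simp [orderStat, hN]

/-! ### Deterministic accuracy of the trimmed mean -/

lemma truncate_eq {γ β : ℝ} (h : γ ≤ β) (x : ℝ) : truncate γ β x = max γ (min β x) := by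
  unfold truncate
  split_ifs with h1 h2
  · rw [min_eq_left h1.le, max_eq_right h]
  · rw [max_eq_left ((min_le_right _ _).trans h2.le)]
  · rw [min_eq_right (not_lt.1 h1), max_eq_right (not_lt.1 h2)]

/-- The upper half of the event on which the trimmed mean is accurate. The first sample `J₁` has few
values above `μ + R`, the second sample `J₂` has few values above the upper empirical quantile of
the first sample, and the deviations in the second sample, clipped at `R`, have a small sum. -/
def UpperRegular {ι : Type*} (J₁ J₂ : Finset ι) (a R : ℝ) (small : Prop) (v : ι → ℝ) (μ : ℝ) :
    Prop :=
  ((J₁.filter fun i => μ + R < v i).card : ℝ) < 3 / 4 * a ∧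
  (small → ∃ i ∈ J₁, a < (J₁.filter fun j => v i ≤ v j).card ∧
    ((J₂.filter fun j => v i < v j).card : ℝ) ≤ 8 * a) ∧
  ∑ j ∈ J₂, max (-R) (min R (v j - μ)) ≤ R * a

/-- Accuracy of the truncated average of a partly corrupted second sample. -/
lemma abs_sum_truncate_sub_le {ι : Type*} [DecidableEq ι] (U J : Finset ι) (hJ : J ⊆ U)
    (v z : ι → ℝ) (hz : ∀ i ∈ J, z i = v i) {γ β μ R a : ℝ} (ha : 0 ≤ a)
    (hγ : μ - R ≤ γ) (hγβ : γ ≤ β) (hβ : β ≤ μ + R)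
    (hbyz : ((U \ J).card : ℝ) ≤ a / 4)
    (hup : ((J.filter fun j => β < v j).card : ℝ) ≤ 8 * a)
    (hlo : ((J.filter fun j => v j < γ).card : ℝ) ≤ 8 * a)
    (hs : |∑ j ∈ J, max (-R) (min R (v j - μ))| ≤ R * a) :
    |∑ i ∈ U, (truncate γ β (z i) - μ)| ≤ 34 * (R * a) := by
  have hR : 0 ≤ R := by linarith
  have hRa : 0 ≤ R * a := mul_nonneg hR ha
  have hrange : ∀ x, |truncate γ β x - μ| ≤ R := fun x => by
    rw [truncate_eq hγβ, abs_le]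
    constructor
    · linarith [le_max_left γ (min β x)]
    · linarith [max_le hγβ (min_le_left β x)]
  have hclip : ∀ x, |max (-R) (min R x)| ≤ R := fun x => by
    rw [abs_le]
    exact ⟨le_max_left _ _, max_le (by linarith) (min_le_left _ _)⟩
  -- Corrupted entries: at most `a / 4` of them, each off by at most `R` after truncation.
  have h1 : |∑ i ∈ U \ J, (truncate γ β (z i) - μ)| ≤ R * (a / 4) := by
    refine (Finset.abs_sum_le_sum_abs _ _).trans ?_
    refine (Finset.sum_le_card_nsmul _ _ R fun i _ => hrange _).trans ?_
    rw [nsmul_eq_mul, mul_comm]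
    exact mul_le_mul_of_nonneg_left hbyz hR
  -- Normal entries: truncation to `[γ, β]` and clipping at distance `R` differ only outside `[γ,
  -- β]`, which concerns at most `8 a + 8 a` entries, by at most `2 R` each.
  have h2 : |∑ j ∈ J, ((truncate γ β (v j) - μ) - max (-R) (min R (v j - μ)))|
      ≤ 32 * (R * a) := by
    refine (Finset.abs_sum_le_sum_abs _ _).trans ?_
    have hterm : ∀ j ∈ J, |(truncate γ β (v j) - μ) - max (-R) (min R (v j - μ))|
        ≤ (if β < v j then 2 * R else 0) + (if v j < γ then 2 * R else 0) := by
      intro j _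
      have h2R : |(truncate γ β (v j) - μ) - max (-R) (min R (v j - μ))| ≤ 2 * R := by
        refine (abs_sub _ _).trans ?_
        linarith [hrange (v j), hclip (v j - μ)]
      by_cases hb : β < v j
      · rw [if_pos hb]
        have : (0 : ℝ) ≤ if v j < γ then 2 * R else 0 := by split_ifs <;> linarith
        linarith
      · by_cases hg : v j < γ
        · rw [if_neg hb, if_pos hg]; linarith
        · rw [if_neg hb, if_neg hg]
          push Not at hb hg
          have e1 : truncate γ β (v j) = v j := by
            rw [truncate_eq hγβ, min_eq_right hb, max_eq_right hg]
          have e2 : max (-R) (min R (v j - μ)) = v j - μ := by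
            rw [min_eq_right (by linarith), max_eq_right (by linarith)]
          rw [e1, e2]; simp
    refine (Finset.sum_le_sum hterm).trans ?_
    rw [Finset.sum_add_distrib, ← Finset.sum_filter, ← Finset.sum_filter, Finset.sum_const,
      Finset.sum_const, nsmul_eq_mul, nsmul_eq_mul]
    nlinarith
  have hsplit : ∑ i ∈ U, (truncate γ β (z i) - μ)
      = ∑ i ∈ U \ J, (truncate γ β (z i) - μ)
        + (∑ j ∈ J, ((truncate γ β (v j) - μ) - max (-R) (min R (v j - μ)))
          + ∑ j ∈ J, max (-R) (min R (v j - μ))) := by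
    rw [← Finset.sum_sdiff hJ, ← Finset.sum_add_distrib]
    congr 1
    refine Finset.sum_congr rfl fun j hj => ?_
    rw [hz j hj]; ring
  rw [hsplit]
  refine (abs_add_le _ _).trans ?_
  have := abs_add_le (∑ j ∈ J, ((truncate γ β (v j) - μ) - max (-R) (min R (v j - μ))))
    (∑ j ∈ J, max (-R) (min R (v j - μ)))
  nlinarith

/-- Probabilities are computed for the family indexed by the normal agents alone, whereas the
trimmed mean uses positions among all agents; this moves the event between the two. -/
lemma upperRegular_map {ι κ : Type*} (e : ι ↪ κ) (J₁ J₂ : Finset ι) (a R : ℝ) (small : Prop)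
    (v : κ → ℝ) (μ : ℝ) :
    UpperRegular (J₁.map e) (J₂.map e) a R small v μ ↔
      UpperRegular J₁ J₂ a R small (fun i => v (e i)) μ := by
  simp [UpperRegular, Finset.filter_map, Finset.sum_map]

/-- The positions of the first half of `M` data. -/
def firstHalf (M : ℕ) : Fin (M / 2) ↪ Fin M :=
  ⟨fun i => ⟨i.1, by omega⟩, fun i j h => by simpa [Fin.ext_iff] using h⟩

/-- The positions of the second half of `M` data. -/
def secondHalf (M : ℕ) : Fin (M / 2) ↪ Fin M :=
  ⟨fun i => ⟨M / 2 + i.1, by omega⟩, fun i j h => by simpa [Fin.ext_iff] using h⟩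

lemma le_orderStat {N : ℕ} (z : Fin N → ℝ) {k : ℕ} (hk : 0 < k) (hkN : k ≤ N) {c : ℝ}
    (h : (Finset.univ.filter fun i => z i < c).card < k) : c ≤ orderStat z k := by
  by_contra! hc
  have h1 := (orderStat_le_iff z hk hkN _).1 le_rfl
  have h2 : (Finset.univ.filter fun i => z i ≤ orderStat z k).card
      ≤ (Finset.univ.filter fun i => z i < c).card :=
    Finset.card_le_card (Finset.monotone_filter_right _ fun i _ hi => lt_of_le_of_lt hi hc)
  omega

/-- The positions outside `B` in the image of an embedding. -/
def normalPart {ι κ : Type*} [Fintype ι] [DecidableEq κ] (B : Finset κ) (e : ι ↪ κ) : Finset κ :=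
  (Finset.univ.map e) \ B

/-- A counted position is either uncorrupted, where `z` and `v` agree, or belongs to `B`. With the
reverse bound `le_card_filter_comp`, this is the only way in which corruption affects the empirical
quantiles. -/
lemma card_filter_comp_le {ι κ : Type*} [Fintype ι] [DecidableEq κ] (B : Finset κ) (e : ι ↪ κ)
    (z v : κ → ℝ) (hz : ∀ i ∉ B, z i = v i) (p : ℝ → Prop) [DecidablePred p] :
    (Finset.univ.filter fun i => p (z (e i))).card
      ≤ ((normalPart B e).filter fun i => p (v i)).card + B.card := by
  have h : ((Finset.univ.filter fun i => p (z (e i))).map e)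
      ⊆ ((normalPart B e).filter fun i => p (v i)) ∪ B := by
    intro k hk
    obtain ⟨i, hi, rfl⟩ := Finset.mem_map.1 hk
    by_cases hB : e i ∈ B
    · exact Finset.mem_union_right _ hB
    · refine Finset.mem_union_left _ (Finset.mem_filter.2 ⟨?_, ?_⟩)
      · exact Finset.mem_sdiff.2 ⟨Finset.mem_map_of_mem e (Finset.mem_univ i), hB⟩
      · rw [← hz _ hB]; exact (Finset.mem_filter.1 hi).2
  have := (Finset.card_le_card h).trans (Finset.card_union_le _ _)
  rwa [Finset.card_map] at this

lemma le_card_filter_comp {ι κ : Type*} [Fintype ι] [DecidableEq κ] (B : Finset κ) (e : ι ↪ κ)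
    (z v : κ → ℝ) (hz : ∀ i ∉ B, z i = v i) (p : ℝ → Prop) [DecidablePred p] :
    ((normalPart B e).filter fun i => p (v i)).card
      ≤ (Finset.univ.filter fun i => p (z (e i))).card := by
  have h : ((normalPart B e).filter fun i => p (v i))
      ⊆ ((Finset.univ.filter fun i => p (z (e i))).map e) := by
    intro k hk
    obtain ⟨hk1, hk2⟩ := Finset.mem_filter.1 hk
    obtain ⟨hk1, hB⟩ := Finset.mem_sdiff.1 hk1
    obtain ⟨i, _, rfl⟩ := Finset.mem_map.1 hk1
    refine Finset.mem_map_of_mem e (Finset.mem_filter.2 ⟨Finset.mem_univ i, ?_⟩)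
    rw [hz _ hB]; exact hk2
  have := Finset.card_le_card h
  rwa [Finset.card_map] at this

lemma card_normalPart_le {ι κ : Type*} [Fintype ι] [DecidableEq κ] (B : Finset κ) (e : ι ↪ κ) :
    (normalPart B e).card ≤ Fintype.card ι :=
  (Finset.card_le_card Finset.sdiff_subset).trans (by simp)

lemma le_card_normalPart {ι κ : Type*} [Fintype ι] [DecidableEq κ] (B : Finset κ) (e : ι ↪ κ) :
    Fintype.card ι ≤ (normalPart B e).card + B.card := by
  have := Finset.le_card_sdiff B (Finset.univ.map e)
  simp only [Finset.card_map, Finset.card_univ] at this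
  unfold normalPart
  omega

/-- On the regular event for `v` and `-v`, the trimmed mean is accurate whatever the entries in
`B` are. -/
lemma abs_trimmedMean_sub_le {M : ℕ} (hM : Even M) (hM0 : 0 < M) (B : Finset (Fin M))
    (z v : Fin M → ℝ) (hz : ∀ i ∉ B, z i = v i) {α δ μ R : ℝ} (hR : 0 ≤ R)
    (hε0 : 0 < trimLevel α δ M) (hε : trimLevel α δ M ≤ 1 / 2)
    (hB : (B.card : ℝ) ≤ trimLevel α δ M * (M / 2 : ℕ) / 4)
    (hup : UpperRegular (normalPart B (firstHalf M)) (normalPart B (secondHalf M))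
      (trimLevel α δ M * (M / 2 : ℕ)) R (trimLevel α δ M < 1 / 4) v μ)
    (hlo : UpperRegular (normalPart B (firstHalf M)) (normalPart B (secondHalf M))
      (trimLevel α δ M * (M / 2 : ℕ)) R (trimLevel α δ M < 1 / 4) (fun i => -v i) (-μ)) :
    |trimmedMean α δ z - μ| ≤ 34 * (R * trimLevel α δ M) := by
  set ε := trimLevel α δ M with hεdef
  set N := M / 2 with hN
  have hMN : (M : ℝ) = 2 * N := by
    obtain ⟨r, hr⟩ := hM
    have : M = 2 * N := by omega
    exact_mod_cast this
  have hN0 : 0 < (N : ℝ) := by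
    have : 0 < (M : ℝ) := by exact_mod_cast hM0
    linarith
  set a := ε * N with ha
  have ha0 : 0 < a := mul_pos hε0 hN0
  have haN : a ≤ N / 2 := by nlinarith
  set k := ⌈ε * M / 2⌉₊ with hk
  set l := ⌈(1 - ε) * M / 2⌉₊ with hl
  -- The two ranks are `⌈a⌉` and `⌈N - a⌉`.
  have ek : ε * M / 2 = a := by rw [hMN]; ring
  have el : (1 - ε) * M / 2 = N - a := by rw [hMN]; ring
  have hk0 : 0 < k := by rw [hk, ek]; exact Nat.ceil_pos.2 ha0
  have hkl : k ≤ l := by rw [hk, hl, ek, el]; exact Nat.ceil_le_ceil (by linarith)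
  have hlN : l ≤ N := by rw [hl, el]; exact Nat.ceil_le.2 (by linarith)
  set Z : Fin N → ℝ := fun i => z (firstHalf M i) with hZ
  set γ := orderStat Z k with hγ
  set β := orderStat Z l with hβ
  have hγβ : γ ≤ β := orderStat_mono Z hk0 hkl hlN
  have hcompl : ∀ c, (Finset.univ.filter fun i => Z i ≤ c).card
      + (Finset.univ.filter fun i => c < Z i).card = N := fun c => by
    have := Finset.card_filter_add_card_filter_not (s := (Finset.univ : Finset (Fin N)))
      (fun i => Z i ≤ c)
    simpa using this
  have hcompl' : ∀ c, (Finset.univ.filter fun i => Z i < c).card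
      + (Finset.univ.filter fun i => c ≤ Z i).card = N := fun c => by
    have := Finset.card_filter_add_card_filter_not (s := (Finset.univ : Finset (Fin N)))
      (fun i => Z i < c)
    simpa using this
  -- Fewer than `3 a / 4` normal and at most `a / 4` corrupted entries exceed `μ + R`, so at least
  -- `N - a` entries do not.
  have hβR : β ≤ μ + R := by
    refine (orderStat_le_iff Z (hk0.trans_le hkl) hlN _).2 ?_
    have h1 := card_filter_comp_le B (firstHalf M) z v hz (fun t => μ + R < t)
    have h2 := hcompl (μ + R)
    rw [hl, el]
    refine Nat.ceil_le.2 ?_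
    have h1' : ((Finset.univ.filter fun i => μ + R < Z i).card : ℝ) ≤ _ := Nat.cast_le.2 h1
    have h2' : ((Finset.univ.filter fun i => Z i ≤ μ + R).card : ℝ)
      + ((Finset.univ.filter fun i => μ + R < Z i).card : ℝ) = N := by exact_mod_cast h2
    push_cast at h1'
    linarith [hup.1]
  have hγR : μ - R ≤ γ := by
    refine le_orderStat Z hk0 (hkl.trans hlN) ?_
    have h1 := card_filter_comp_le B (firstHalf M) z v hz (fun t => t < μ - R)
    rw [hk, ek]
    refine Nat.lt_ceil.2 ?_
    have h1' : ((Finset.univ.filter fun i => Z i < μ - R).card : ℝ) ≤ _ := Nat.cast_le.2 h1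
    have h2 := hlo.1
    have e : ∀ i, (-μ + R < -v i) = (v i < μ - R) := fun i =>
      propext ⟨fun h => by linarith, fun h => by linarith⟩
    simp only [e] at h2
    push_cast at h1'
    linarith
  have hJ₂ : ((normalPart B (secondHalf M)).card : ℝ) ≤ N := by
    have := card_normalPart_le B (secondHalf M)
    rw [Fintype.card_fin] at this
    exact_mod_cast this
  have hup' : (((normalPart B (secondHalf M)).filter fun j => β < v j).card : ℝ) ≤ 8 * a := by
    by_cases hs : ε < 1 / 4
    · obtain ⟨i, _, hi1, hi2⟩ := hup.2.1 hs
      -- More than `a` entries are at least `v i`, hence fewer than `N - a` lie below it.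
      have hq : v i ≤ β := by
        refine le_orderStat Z (hk0.trans_le hkl) hlN ?_
        have h1 := le_card_filter_comp B (firstHalf M) z v hz (fun t => v i ≤ t)
        have h2 := hcompl' (v i)
        rw [hl, el]
        refine Nat.lt_ceil.2 ?_
        have h1' : _ ≤ ((Finset.univ.filter fun j => v i ≤ Z j).card : ℝ) := Nat.cast_le.2 h1
        have h2' : ((Finset.univ.filter fun j => Z j < v i).card : ℝ)
          + ((Finset.univ.filter fun j => v i ≤ Z j).card : ℝ) = N := by exact_mod_cast h2
        linarith
      refine le_trans (Nat.cast_le.2 (Finset.card_le_card ?_)) hi2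
      exact Finset.monotone_filter_right _ fun j _ hj => lt_of_le_of_lt hq hj
    -- For `ε ≥ 1 / 4` the bound `8 a ≥ 2 N` is trivial.
    · have := Finset.card_filter_le (normalPart B (secondHalf M)) (fun j => β < v j)
      have : (((normalPart B (secondHalf M)).filter fun j => β < v j).card : ℝ) ≤ _ :=
        Nat.cast_le.2 this
      nlinarith
  have hlo' : (((normalPart B (secondHalf M)).filter fun j => v j < γ).card : ℝ) ≤ 8 * a := by
    by_cases hs : ε < 1 / 4
    · obtain ⟨i, _, hi1, hi2⟩ := hlo.2.1 hs
      simp only [neg_le_neg_iff, neg_lt_neg_iff] at hi1 hi2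
      have hq : γ ≤ v i := by
        refine (orderStat_le_iff Z hk0 (hkl.trans hlN) _).2 ?_
        have h1 := le_card_filter_comp B (firstHalf M) z v hz (fun t => t ≤ v i)
        rw [hk, ek]
        refine Nat.ceil_le.2 (hi1.le.trans (Nat.cast_le.2 h1))
      refine le_trans (Nat.cast_le.2 (Finset.card_le_card ?_)) hi2
      exact Finset.monotone_filter_right _ fun j _ hj => lt_of_lt_of_le hj hq
    · have := Finset.card_filter_le (normalPart B (secondHalf M)) (fun j => v j < γ)
      have : (((normalPart B (secondHalf M)).filter fun j => v j < γ).card : ℝ) ≤ _ :=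
        Nat.cast_le.2 this
      nlinarith
  have hsum : |∑ j ∈ normalPart B (secondHalf M), max (-R) (min R (v j - μ))| ≤ R * a := by
    have h2 := hlo.2.2
    -- Clipping is odd, so regularity of `-v` bounds the same sum from below.
    have e : ∀ i, max (-R) (min R (-v i - -μ)) = -max (-R) (min R (v i - μ)) := fun i => by
      rw [← min_neg_neg, ← max_neg_neg, neg_neg, max_min_distrib_left]
      rw [max_eq_right (by linarith : -R ≤ R)]
      congr 2; ring
    simp only [e, Finset.sum_neg_distrib] at h2
    exact abs_le.2 ⟨by linarith, hup.2.2⟩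
  have hbyz : (((Finset.univ.map (secondHalf M)) \ normalPart B (secondHalf M)).card : ℝ)
      ≤ a / 4 := by
    refine le_trans (Nat.cast_le.2 (Finset.card_le_card ?_)) hB
    intro i hi
    by_contra hiB
    obtain ⟨h1, h2⟩ := Finset.mem_sdiff.1 hi
    exact h2 (Finset.mem_sdiff.2 ⟨h1, hiB⟩)
  have key := abs_sum_truncate_sub_le (Finset.univ.map (secondHalf M))
    (normalPart B (secondHalf M)) Finset.sdiff_subset v z
    (fun i hi => hz i (Finset.mem_sdiff.1 hi).2) ha0.le hγR hγβ hβR hbyz hup' hlo' hsum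
  have htm : trimmedMean α δ z - μ
      = (1 / N) * ∑ i ∈ Finset.univ.map (secondHalf M), (truncate γ β (z i) - μ) := by
    have : trimmedMean α δ z
      = 2 / (M : ℝ) * ∑ i : Fin N, truncate γ β (z (secondHalf M i)) := rfl
    rw [this, Finset.sum_map, Finset.sum_sub_distrib, Finset.sum_const, Finset.card_univ,
      Fintype.card_fin, nsmul_eq_mul, hMN]
    change _ = 1 / (N : ℝ) * (_ - (N : ℝ) * μ)
    field_simp
    rfl
  rw [htm, abs_mul, abs_of_pos (by positivity)]
  calc 1 / (N : ℝ) * _ ≤ 1 / N * (34 * (R * a)) := by gcongr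
    _ = 34 * (R * ε) := by rw [ha]; field_simp

/-! ### Quantiles, Chernoff bounds and the probability of regularity -/

/-- Existence of an upper `p`-quantile. -/
lemma exists_upper_quantile (ν : Measure ℝ) [IsProbabilityMeasure ν] {p : ℝ} (hp0 : 0 < p)
    (hp1 : p < 1) : ∃ q, ν.real (Set.Ioi q) ≤ p ∧ p ≤ ν.real (Set.Ici q) := by
  set G := cdf ν
  set A := {x : ℝ | 1 - p ≤ G x} with hA
  have hne : A.Nonempty := by
    obtain ⟨x, hx⟩ := ((tendsto_cdf_atTop ν).eventually (lt_mem_nhds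
      (show 1 - p < 1 by linarith))).exists
    exact ⟨x, hx.le⟩
  have hbdd : BddBelow A := by
    obtain ⟨x, hx⟩ := ((tendsto_cdf_atBot ν).eventually (gt_mem_nhds
      (show 0 < 1 - p by linarith))).exists
    refine ⟨x, fun y hy => ?_⟩
    by_contra! h
    have : G y ≤ G x := (monotone_cdf ν) h.le
    have : 1 - p ≤ G y := hy
    linarith
  set q := sInf A
  have hlt : ∀ x < q, G x ≤ 1 - p := fun x hx => by
    by_contra! h
    exact absurd (csInf_le hbdd h.le) (not_le.2 hx)
  have hgt : ∀ x, q < x → 1 - p ≤ G x := fun x hx => by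
    obtain ⟨y, hy, hyx⟩ := exists_lt_of_csInf_lt hne hx
    exact le_trans (show 1 - p ≤ G y from hy) ((monotone_cdf ν) hyx.le)
  refine ⟨q, ?_, ?_⟩
  -- Right continuity gives the bound on the open tail, the left limit at `q` the one on the closed
  -- tail; the two differ by a possible atom at `q`.
  · have h1 : 1 - p ≤ G q := by
      refine ge_of_tendsto ((G.right_continuous q).tendsto.mono_left
        (nhdsWithin_mono q Set.Ioi_subset_Ici_self)) ?_
      filter_upwards [self_mem_nhdsWithin] with x hx using hgt x hx
    have h2 : ν.real (Set.Ioi q) = 1 - G q := by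
      rw [← Set.compl_Iic, measureReal_compl measurableSet_Iic, cdf_eq_real]
      simp
    linarith
  · have h1 : ν.real (Set.Iio q) ≤ 1 - p := by
      have h3 : ν (Set.Iio q) = ENNReal.ofReal (Function.leftLim G q) := by
        rw [← measure_cdf ν, StieltjesFunction.measure_Iio _ (tendsto_cdf_atBot _)]
        simp [G]
      have h4 : Function.leftLim G q ≤ 1 - p := by
        refine le_of_tendsto ((monotone_cdf ν).tendsto_leftLim q) ?_
        filter_upwards [self_mem_nhdsWithin] with x hx using hlt x hx
      rw [measureReal_def, h3]
      exact ENNReal.toReal_le_of_le_ofReal (by linarith) (ENNReal.ofReal_le_ofReal h4)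
    have h2 : ν.real (Set.Ici q) = 1 - ν.real (Set.Iio q) := by
      rw [← Set.compl_Iio, measureReal_compl measurableSet_Iio]
      simp
    linarith

lemma sum_indicator_eq {Ξ ι : Type*} (J : Finset ι) (s : ι → Ξ) (A : Set Ξ) [DecidablePred fun x => x ∈ A]
    (l : ℝ) :
    ∑ i ∈ J, A.indicator (fun _ => l) (s i) = (J.filter fun i => s i ∈ A).card * l := by
  rw [← nsmul_eq_mul, ← Finset.sum_const, Finset.sum_filter]
  refine Finset.sum_congr rfl fun i _ => ?_
  by_cases h : s i ∈ A <;> simp [h]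

section

variable {Ξ : Type*} [MeasurableSpace Ξ] {𝒟 : Measure Ξ} [IsProbabilityMeasure 𝒟]
  {ι : Type*} [Fintype ι]

/-- Chernoff bound for sums of i.i.d. bounded variables. -/
lemma pi_real_le_sum_le {g : Ξ → ℝ} (hg : Measurable g) (hb : ∀ x, |g x| ≤ 1) {c : ℝ}
    (hc : ∫ x, Real.exp (g x) ∂𝒟 ≤ Real.exp c) (J : Finset ι) (a : ℝ) :
    (Measure.pi fun _ : ι => 𝒟).real {s | a ≤ ∑ i ∈ J, g (s i)} ≤ Real.exp (J.card * c - a) := by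
  set W : ι → (ι → Ξ) → ℝ := fun i s => g (s i)
  have hW : ∀ i, Measurable (W i) := fun i => hg.comp (measurable_pi_apply i)
  have hind : iIndepFun W (Measure.pi fun _ : ι => 𝒟) :=
    iIndepFun_pi (X := fun _ => g) fun _ => hg.aemeasurable
  have hmgf : ∀ i, mgf (W i) (Measure.pi fun _ : ι => 𝒟) 1 ≤ Real.exp c := fun i => by
    have h := (measurePreserving_eval (fun _ : ι => 𝒟) i).map_eq
    have h2 : ∫ x, Real.exp (g x) ∂((Measure.pi fun _ : ι => 𝒟).map (Function.eval i))
        = ∫ s, Real.exp (g (s i)) ∂(Measure.pi fun _ : ι => 𝒟) :=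
      integral_map (measurable_pi_apply i).aemeasurable hg.exp.aestronglyMeasurable
    rw [h] at h2
    simp only [mgf, one_mul]
    exact h2 ▸ hc
  have hint : Integrable (fun s => Real.exp (1 * ∑ i ∈ J, g (s i)))
      (Measure.pi fun _ : ι => 𝒟) := by
    refine Integrable.of_bound (C := Real.exp J.card) ?_ (Filter.Eventually.of_forall fun s => ?_)
    · exact ((Finset.measurable_sum _ fun i _ => hW i).const_mul 1).exp.aestronglyMeasurable
    · rw [Real.norm_eq_abs, Real.abs_exp, Real.exp_le_exp, one_mul]
      refine (Finset.sum_le_card_nsmul J _ 1 fun i _ => (le_abs_self _).trans (hb _)).trans ?_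
      simp
  refine (measure_ge_le_exp_mul_mgf a zero_le_one hint).trans ?_
  have hsum : mgf (fun s => ∑ i ∈ J, g (s i)) (Measure.pi fun _ : ι => 𝒟) 1
      = ∏ i ∈ J, mgf (W i) (Measure.pi fun _ : ι => 𝒟) 1 := by
    rw [← hind.mgf_sum hW]
    congr 1
    ext s; simp [W]
  rw [hsum, sub_eq_add_neg, add_comm, Real.exp_add]
  have : -1 * a = -a := by ring
  rw [this]
  refine mul_le_mul_of_nonneg_left ?_ (Real.exp_pos _).le
  refine (Finset.prod_le_prod (fun i _ => mgf_nonneg) fun i _ => hmgf i).trans ?_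
  rw [Finset.prod_const, ← Real.exp_nat_mul]

/-- The integral equals `1 + (exp l - 1) * 𝒟.real A`, and `1 + x ≤ exp x`. -/
lemma integral_exp_indicator {A : Set Ξ} (hA : MeasurableSet A) (l : ℝ) :
    ∫ x, Real.exp (A.indicator (fun _ => l) x) ∂𝒟 ≤ Real.exp ((Real.exp l - 1) * 𝒟.real A) := by
  have h : ∀ x, Real.exp (A.indicator (fun _ => l) x)
      = 1 + A.indicator (fun _ => Real.exp l - 1) x := fun x => by
    by_cases hx : x ∈ A <;> simp [hx]
  simp_rw [h]
  rw [integral_add (integrable_const _) ((integrable_const _).indicator hA),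
    integral_indicator hA]
  simp only [integral_const, smul_eq_mul, probReal_univ, measureReal_restrict_apply_univ]
  have := Real.add_one_le_exp ((Real.exp l - 1) * 𝒟.real A)
  linarith

/-- Few samples fall into a rare set. -/
lemma pi_real_card_ge_le {A : Set Ξ} (hA : MeasurableSet A) [DecidablePred fun x => x ∈ A]
    (J : Finset ι) (a : ℝ) :
    (Measure.pi fun _ : ι => 𝒟).real {s | a ≤ ((J.filter fun i => s i ∈ A).card : ℝ)}
      ≤ Real.exp (J.card * (7 / 4 * 𝒟.real A) - a) := by
  have h := pi_real_le_sum_le (𝒟 := 𝒟) (g := A.indicator fun _ => (1 : ℝ))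
    (measurable_const.indicator hA) (fun x => by by_cases hx : x ∈ A <;> simp [hx])
    (integral_exp_indicator hA 1) J a
  simp only [sum_indicator_eq, mul_one] at h
  refine h.trans (Real.exp_le_exp.2 ?_)
  -- `7 / 4` is an upper bound for `e - 1`.
  have := Real.exp_one_lt_d9
  gcongr
  linarith

/-- Many samples fall into a frequent set. -/
lemma pi_real_card_le_le {A : Set Ξ} (hA : MeasurableSet A) [DecidablePred fun x => x ∈ A]
    (J : Finset ι) (a : ℝ) :
    (Measure.pi fun _ : ι => 𝒟).real {s | ((J.filter fun i => s i ∈ A).card : ℝ) ≤ a}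
      ≤ Real.exp (a - J.card * (5 / 8 * 𝒟.real A)) := by
  have h := pi_real_le_sum_le (𝒟 := 𝒟) (g := A.indicator fun _ => (-1 : ℝ))
    (measurable_const.indicator hA) (fun x => by by_cases hx : x ∈ A <;> simp [hx])
    (integral_exp_indicator hA (-1)) J (-a)
  simp only [sum_indicator_eq, mul_neg, mul_one, neg_le_neg_iff] at h
  refine h.trans (Real.exp_le_exp.2 ?_)
  have he : Real.exp (-1) ≤ 3 / 8 := by
    rw [Real.exp_neg, inv_le_comm₀ (Real.exp_pos _) (by norm_num)]
    have := Real.exp_one_gt_d9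
    linarith
  have : (J.card : ℝ) * ((Real.exp (-1) - 1) * 𝒟.real A) ≤ J.card * ((-(5 / 8)) * 𝒟.real A) := by
    gcongr
    linarith
  linarith

/-- Chebyshev's inequality for one tail, including a vanishing deviation. -/
lemma real_tail_le {h : Ξ → ℝ} {μ σ R ε : ℝ}
    (hint : Integrable (fun x => (h x - μ) ^ 2) 𝒟) (hvar : ∫ x, (h x - μ) ^ 2 ∂𝒟 ≤ σ ^ 2)
    (hR : 0 ≤ R) (hε : 0 ≤ ε) (hσ : σ ^ 2 = R ^ 2 * (ε / 4)) :
    𝒟.real {x | μ + R < h x} ≤ ε / 4 := by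
  -- If `R = 0` the variance vanishes and `h = μ` almost everywhere.
  rcases hR.eq_or_lt with rfl | hR0
  · have h0 : ∫ x, (h x - μ) ^ 2 ∂𝒟 = 0 :=
      le_antisymm (by simpa [hσ] using hvar) (integral_nonneg fun x => sq_nonneg _)
    have h1 := (integral_eq_zero_iff_of_nonneg (fun x => sq_nonneg _) hint).1 h0
    have h2 : 𝒟 {x | μ + 0 < h x} = 0 := by
      refine measure_mono_null ?_ (ae_iff.1 h1)
      intro x hx
      have hx : μ + 0 < h x := hx
      have : h x - μ ≠ 0 := by linarith
      simpa using this
    rw [measureReal_def, h2]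
    simp; linarith
  · have h1 := mul_meas_ge_le_integral_of_nonneg (μ := 𝒟) (f := fun x => (h x - μ) ^ 2)
      (Filter.Eventually.of_forall fun x => sq_nonneg _) hint (R ^ 2)
    have h2 : 𝒟.real {x | μ + R < h x} ≤ 𝒟.real {x | R ^ 2 ≤ (h x - μ) ^ 2} := by
      refine measureReal_mono fun x hx => ?_
      have hx : μ + R < h x := hx
      exact pow_le_pow_left₀ hR (by linarith) 2
    have h3 : R ^ 2 * 𝒟.real {x | μ + R < h x} ≤ R ^ 2 * (ε / 4) := by
      rw [← hσ]
      exact (mul_le_mul_of_nonneg_left h2 (sq_nonneg R)).trans (h1.trans hvar)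
    exact le_of_mul_le_mul_left h3 (by positivity)

lemma abs_clip_le_one (y : ℝ) : |max (-1) (min 1 y)| ≤ 1 :=
  abs_le.2 ⟨le_max_left _ _, max_le (by norm_num) (min_le_left _ _)⟩

/-- On `[-1, 1]` this follows from `exp x ≤ 1 + x + x ^ 2`; outside, the quadratic term pays for the
clipping. Keeping the unclipped `y` as linear term makes it integrate to zero, so the bias of
clipping needs no separate estimate. -/
lemma exp_clip_le (y : ℝ) : Real.exp (max (-1) (min 1 y)) ≤ 1 + y + 2 * y ^ 2 := by
  have h1 := (abs_le.1 (Real.abs_exp_sub_one_sub_id_le (abs_clip_le_one y))).2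
  rcases le_total y (-1) with h | h
  · rw [min_eq_right (by linarith), max_eq_left h] at *
    nlinarith
  · rcases le_total y 1 with h' | h'
    · rw [min_eq_right h', max_eq_right h] at *
      nlinarith
    · rw [min_eq_left h', max_eq_right (by norm_num)] at *
      nlinarith

/-- Exponential moment of a clipped deviation. -/
lemma integral_exp_clip_le {h : Ξ → ℝ} {μ σ R ε : ℝ} (hi : Integrable h 𝒟)
    (hmean : ∫ x, h x ∂𝒟 = μ)
    (hint : Integrable (fun x => (h x - μ) ^ 2) 𝒟) (hvar : ∫ x, (h x - μ) ^ 2 ∂𝒟 ≤ σ ^ 2)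
    (hε : 0 ≤ ε) (hσ : σ ^ 2 = R ^ 2 * (ε / 4)) :
    ∫ x, Real.exp (max (-1) (min 1 ((h x - μ) / R))) ∂𝒟 ≤ Real.exp (ε / 2) := by
  have hi1 : Integrable (fun x => (h x - μ) / R) 𝒟 := (hi.sub (integrable_const μ)).div_const R
  have hi2 : Integrable (fun x => 2 * ((h x - μ) / R) ^ 2) 𝒟 := by
    simp_rw [div_pow]
    exact (hint.div_const _).const_mul 2
  have hle : ∫ x, Real.exp (max (-1) (min 1 ((h x - μ) / R))) ∂𝒟
      ≤ ∫ x, (1 + (h x - μ) / R + 2 * ((h x - μ) / R) ^ 2) ∂𝒟 := by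
    refine integral_mono_of_nonneg (Filter.Eventually.of_forall fun x => (Real.exp_pos _).le)
      (((integrable_const 1).add hi1).add hi2) (Filter.Eventually.of_forall fun x => exp_clip_le _)
  have h1 : ∫ x, (h x - μ) / R ∂𝒟 = 0 := by
    rw [integral_div, integral_sub hi (integrable_const μ), hmean]
    simp
  have h2 : ∫ x, 2 * ((h x - μ) / R) ^ 2 ∂𝒟 ≤ ε / 2 := by
    simp_rw [div_pow]
    rw [integral_const_mul, integral_div]
    have : (∫ x, (h x - μ) ^ 2 ∂𝒟) / R ^ 2 ≤ ε / 4 := by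
      refine div_le_of_le_mul₀ (sq_nonneg R) (by linarith) ?_
      rw [mul_comm, ← hσ]; exact hvar
    linarith
  have h3 : ∫ x, (1 + (h x - μ) / R + 2 * ((h x - μ) / R) ^ 2) ∂𝒟 ≤ 1 + ε / 2 := by
    have hi3 : Integrable (fun x => 1 + (h x - μ) / R) 𝒟 := (integrable_const 1).add hi1
    rw [integral_add hi3 hi2, integral_add (integrable_const 1) hi1, h1]
    simp only [integral_const, probReal_univ, smul_eq_mul]
    linarith
  have := Real.add_one_le_exp (ε / 2)
  linarith

/-- Rescaling to the unit clip puts the sum within reach of the Chernoff bound. The case `R = 0` is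
consistent, since both sides are zero. -/
lemma mul_clip_div {R : ℝ} (hR : 0 ≤ R) (x : ℝ) :
    max (-R) (min R x) = R * max (-1) (min 1 (x / R)) := by
  rcases hR.eq_or_lt with rfl | hR
  · simp
  · rw [mul_max_of_nonneg _ _ hR.le, mul_min_of_nonneg _ _ hR.le, mul_div_cancel₀ _ hR.ne']
    simp

/-- Regularity of the normal agents' samples for a fixed function fails with small probability. -/
lemma pi_real_not_upperRegular_le {h : Ξ → ℝ} {μ σ R ε N : ℝ} (hm : Measurable h)
    (hi : Integrable h 𝒟) (hmean : ∫ x, h x ∂𝒟 = μ)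
    (hint : Integrable (fun x => (h x - μ) ^ 2) 𝒟) (hvar : ∫ x, (h x - μ) ^ 2 ∂𝒟 ≤ σ ^ 2)
    (hR : 0 ≤ R) (hε : 0 < ε) (hσ : σ ^ 2 = R ^ 2 * (ε / 4)) (hN : 0 < N)
    (J₁ J₂ : Finset ι) (h₁ : J₁.card ≤ N) (h₁' : 7 / 8 * N ≤ J₁.card) (h₂ : J₂.card ≤ N) :
    (Measure.pi fun _ : ι => 𝒟).real
        {s | ¬ UpperRegular J₁ J₂ (ε * N) R (ε < 1 / 4) (fun i => h (s i)) μ}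
      ≤ 4 * Real.exp (-(ε * N / 4)) := by
  classical
  set Q := Measure.pi fun _ : ι => 𝒟
  have hεN : 0 < ε * N := mul_pos hε hN
  set E₁ := {s : ι → Ξ | 3 / 4 * (ε * N) ≤ ((J₁.filter fun i => s i ∈ {x | μ + R < h x}).card : ℝ)}
  set E₂ := {s : ι → Ξ | ε * N ≤ ∑ j ∈ J₂, max (-1) (min 1 ((h (s j) - μ) / R))}
  have b₁ : Q.real E₁ ≤ Real.exp (-(ε * N / 4)) := by
    refine (pi_real_card_ge_le (measurableSet_lt measurable_const hm) J₁ _).trans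
      (Real.exp_le_exp.2 ?_)
    have hp := real_tail_le hint hvar hR hε.le hσ
    have : (J₁.card : ℝ) * (7 / 4 * 𝒟.real {x | μ + R < h x}) ≤ N * (7 / 4 * (ε / 4)) := by
      gcongr
    nlinarith
  have b₂ : Q.real E₂ ≤ Real.exp (-(ε * N / 4)) := by
    refine (pi_real_le_sum_le (g := fun x => max (-1) (min 1 ((h x - μ) / R)))
      (by fun_prop) (fun x => abs_clip_le_one _)
      (integral_exp_clip_le hi hmean hint hvar hε.le hσ) J₂ _).trans (Real.exp_le_exp.2 ?_)
    have : (J₂.card : ℝ) * (ε / 2) ≤ N * (ε / 2) := by gcongr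
    nlinarith
  obtain ⟨E₃, b₃, hE₃⟩ : ∃ E₃ : Set (ι → Ξ), Q.real E₃ ≤ 2 * Real.exp (-(ε * N / 4)) ∧
      ∀ s ∉ E₃, ε < 1 / 4 → ∃ i ∈ J₁, ε * N < (J₁.filter fun j => h (s i) ≤ h (s j)).card ∧
        ((J₂.filter fun j => h (s i) < h (s j)).card : ℝ) ≤ 8 * (ε * N) := by
    by_cases hs : ε < 1 / 4
    · have hprob : IsProbabilityMeasure (𝒟.map h) := Measure.isProbabilityMeasure_map hm.aemeasurable
      -- At level `4 ε` the first sample has on average at least `3.5 ε N` values in `[q, ∞)`,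
      -- against the threshold `ε N`, and the second at most `4 ε N` in `(q, ∞)`, against `8 ε N`.
      -- The level is below 1 because `ε < 1 / 4`.
      obtain ⟨q, hq1, hq2⟩ := exists_upper_quantile (𝒟.map h) (p := 4 * ε) (by linarith)
        (by linarith)
      rw [measureReal_def, Measure.map_apply hm measurableSet_Ioi, ← measureReal_def] at hq1
      rw [measureReal_def, Measure.map_apply hm measurableSet_Ici, ← measureReal_def] at hq2
      refine ⟨{s | ((J₁.filter fun i => s i ∈ h ⁻¹' Set.Ici q).card : ℝ) ≤ ε * N} ∪
        {s | 8 * (ε * N) ≤ ((J₂.filter fun i => s i ∈ h ⁻¹' Set.Ioi q).card : ℝ)}, ?_, ?_⟩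
      · refine (measureReal_union_le _ _).trans ?_
        have c₁ : Q.real {s | ((J₁.filter fun i => s i ∈ h ⁻¹' Set.Ici q).card : ℝ) ≤ ε * N}
            ≤ Real.exp (-(ε * N / 4)) := by
          refine (pi_real_card_le_le (hm measurableSet_Ici) J₁ _).trans (Real.exp_le_exp.2 ?_)
          have : (7 / 8 * N) * (5 / 8 * (4 * ε))
              ≤ (J₁.card : ℝ) * (5 / 8 * 𝒟.real (h ⁻¹' Set.Ici q)) := by gcongr
          nlinarith
        have c₂ : Q.real {s | 8 * (ε * N) ≤ ((J₂.filter fun i => s i ∈ h ⁻¹' Set.Ioi q).card : ℝ)}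
            ≤ Real.exp (-(ε * N / 4)) := by
          refine (pi_real_card_ge_le (hm measurableSet_Ioi) J₂ _).trans (Real.exp_le_exp.2 ?_)
          have : (J₂.card : ℝ) * (7 / 4 * 𝒟.real (h ⁻¹' Set.Ioi q)) ≤ N * (7 / 4 * (4 * ε)) := by
            gcongr
          nlinarith
        linarith
      · intro s hs' _
        simp only [Set.mem_union, Set.mem_ofPred_eq, not_or, not_le, Set.mem_preimage, Set.mem_Ici,
          Set.mem_Ioi] at hs'
        obtain ⟨d₁, d₂⟩ := hs'
        -- The witness is an index of the smallest first-sample value that is at least `q`: every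
        -- first-sample value in `[q, ∞)` is at least it, and whatever exceeds it exceeds `q`.
        have hne : (J₁.filter fun i => q ≤ h (s i)).Nonempty := by
          rw [← Finset.card_pos]
          exact_mod_cast hεN.trans d₁
        obtain ⟨i, hi, hmin⟩ := Finset.exists_min_image _ (fun i => h (s i)) hne
        obtain ⟨hi1, hi2⟩ := Finset.mem_filter.1 hi
        refine ⟨i, hi1, d₁.trans_le (Nat.cast_le.2 (Finset.card_le_card fun j hj => ?_)),
          (Nat.cast_le.2 (Finset.card_le_card ?_)).trans d₂.le⟩
        · exact Finset.mem_filter.2 ⟨(Finset.mem_filter.1 hj).1, hmin j hj⟩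
        · exact Finset.monotone_filter_right _ fun j _ hj => lt_of_le_of_lt hi2 hj
    · exact ⟨∅, by simpa using (Real.exp_pos _).le, fun s _ h => absurd h hs⟩
  have hsub : {s | ¬ UpperRegular J₁ J₂ (ε * N) R (ε < 1 / 4) (fun i => h (s i)) μ}
      ⊆ E₁ ∪ E₂ ∪ E₃ := by
    intro s hs
    by_contra hc
    simp only [Set.mem_union, not_or] at hc
    refine hs ⟨not_le.1 hc.1.1, hE₃ s hc.2, ?_⟩
    have h1 : ∑ j ∈ J₂, max (-1) (min 1 ((h (s j) - μ) / R)) < ε * N := not_le.1 fun h => hc.1.2 h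
    simp_rw [mul_clip_div hR]
    rw [← Finset.mul_sum]
    exact mul_le_mul_of_nonneg_left h1.le hR
  have := measureReal_mono (μ := Q) hsub
  have := measureReal_union_le (μ := Q) (E₁ ∪ E₂) E₃
  have := measureReal_union_le (μ := Q) E₁ E₂
  linarith

end

/-! ### Fresh samples at a random point -/

lemma measurable_card_filter {α ι : Type*} [MeasurableSpace α] (J : Finset ι)
    {p : α → ι → Prop} [∀ x, DecidablePred (p x)] (hp : ∀ i, MeasurableSet {x | p x i}) :
    Measurable fun x => ((J.filter fun i => p x i).card : ℝ) := by
  simp_rw [Finset.card_filter]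
  push_cast
  exact Finset.measurable_sum _ fun i _ => Measurable.ite (hp i) measurable_const measurable_const

/-- The quantile condition is witnessed by an index of the sample, so it is a finite union of
counting events. A population quantile would have to be shown measurable in the random query point.
-/
lemma measurableSet_upperRegular {α ι : Type*} [MeasurableSpace α] (J₁ J₂ : Finset ι) (a R : ℝ)
    (small : Prop) {v : α → ι → ℝ} {μ : α → ℝ} (hv : ∀ i, Measurable fun x => v x i)
    (hμ : Measurable μ) :
    MeasurableSet {x | UpperRegular J₁ J₂ a R small (v x) (μ x)} := by
  refine MeasurableSet.inter (s₁ := {x | ((J₁.filter fun i => μ x + R < v x i).card : ℝ)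
      < 3 / 4 * a}) ?_ (MeasurableSet.inter (s₁ := {x | small → ∃ i ∈ J₁,
        a < (J₁.filter fun j => v x i ≤ v x j).card ∧
        ((J₂.filter fun j => v x i < v x j).card : ℝ) ≤ 8 * a})
      (s₂ := {x | ∑ j ∈ J₂, max (-R) (min R (v x j - μ x)) ≤ R * a}) ?_ ?_)
  · refine measurableSet_lt (measurable_card_filter J₁ fun i => ?_) measurable_const
    exact measurableSet_lt (hμ.add_const R) (hv i)
  · by_cases hs : small
    · have : {x | small → ∃ i ∈ J₁, a < (J₁.filter fun j => v x i ≤ v x j).card ∧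
          ((J₂.filter fun j => v x i < v x j).card : ℝ) ≤ 8 * a}
          = ⋃ i ∈ J₁, ({x | a < ((J₁.filter fun j => v x i ≤ v x j).card : ℝ)} ∩
            {x | ((J₂.filter fun j => v x i < v x j).card : ℝ) ≤ 8 * a}) := by
        ext x; simp [hs, and_left_comm]
      rw [this]
      refine Finset.measurableSet_biUnion _ fun i _ => MeasurableSet.inter ?_ ?_
      · exact measurableSet_lt measurable_const
          (measurable_card_filter J₁ fun j => measurableSet_le (hv i) (hv j))
      · exact measurableSet_le
          (measurable_card_filter J₂ fun j => measurableSet_lt (hv i) (hv j)) measurable_const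
    · simp [hs]
  · refine measurableSet_le (Finset.measurable_sum _ fun j _ => ?_) measurable_const
    exact measurable_const.max (measurable_const.min ((hv j).sub hμ))

/-- Regularity of fresh samples at a random point that is determined by the past. -/
lemma measure_not_upperRegular_le {Ξ : Type*} [MeasurableSpace Ξ] {𝒟 : Measure Ξ}
    [IsProbabilityMeasure 𝒟] {ι : Type*} [Fintype ι] {Ω : Type*} {m mΩ : MeasurableSpace Ω}
    {P : Measure Ω} [IsProbabilityMeasure P] (hle : m ≤ mΩ) {W : Type*} [MeasurableSpace W]
    {w : Ω → W} (hw : Measurable[m] w) {ξ : ι → Ω → Ξ} (hξ : ∀ i, Measurable (ξ i))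
    (hlaw : ∀ i, P.map (ξ i) = 𝒟) (hind : iIndepFun ξ P)
    (hpast : Indep (⨆ i, MeasurableSpace.comap (ξ i) inferInstance) m P)
    {h : W → Ξ → ℝ} (hm : Measurable (Function.uncurry h)) {σ R ε N : ℝ}
    (hL2 : ∀ ω, MemLp (h (w ω)) 2 𝒟)
    (hvar : ∀ ω, ∫ x, (h (w ω) x - ∫ y, h (w ω) y ∂𝒟) ^ 2 ∂𝒟 ≤ σ ^ 2)
    (hR : 0 ≤ R) (hε : 0 < ε) (hσ : σ ^ 2 = R ^ 2 * (ε / 4)) (hN : 0 < N)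
    (J₁ J₂ : Finset ι) (h₁ : J₁.card ≤ N) (h₁' : 7 / 8 * N ≤ J₁.card) (h₂ : J₂.card ≤ N) :
    P {ω | ¬ UpperRegular J₁ J₂ (ε * N) R (ε < 1 / 4) (fun i => h (w ω) (ξ i ω))
        (∫ y, h (w ω) y ∂𝒟)} ≤ ENNReal.ofReal (4 * Real.exp (-(ε * N / 4))) := by
  have hw' : Measurable w := hw.mono hle le_rfl
  set X : Ω → (ι → Ξ) := fun ω i => ξ i ω
  have hX : Measurable X := measurable_pi_lambda _ hξ
  have hmapX : P.map X = Measure.pi fun _ => 𝒟 := by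
    rw [(iIndepFun_iff_map_fun_eq_pi_map fun i => (hξ i).aemeasurable).1 hind]
    simp_rw [hlaw]
  have hindwX : IndepFun w X P := by
    refine (indep_of_indep_of_le_left (indep_of_indep_of_le_right hpast hw.comap_le) ?_).symm
    rw [← measurable_iff_comap_le]
    refine @measurable_pi_lambda _ _ _ (_) _ _ fun i => ?_
    exact (comap_measurable (ξ i)).mono (le_iSup (fun i => MeasurableSpace.comap (ξ i) _) i) le_rfl
  -- The query point and the samples have a product law, so the bound for a fixed point is
  -- integrated over the law of the point.
  have hmap := (indepFun_iff_map_prod_eq_prod_map_map hw'.aemeasurable hX.aemeasurable).1 hindwX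
  set A : Set (W × (ι → Ξ)) := {p | UpperRegular J₁ J₂ (ε * N) R (ε < 1 / 4)
    (fun i => h p.1 (p.2 i)) (∫ y, h p.1 y ∂𝒟)}
  have hA : MeasurableSet A := by
    refine measurableSet_upperRegular J₁ J₂ _ _ _ (fun i => ?_) ?_
    · exact hm.comp (measurable_fst.prodMk ((measurable_pi_apply i).comp measurable_snd))
    · exact (hm.stronglyMeasurable.integral_prod_right (ν := 𝒟)).measurable.comp measurable_fst
  have hpre : {ω | ¬ UpperRegular J₁ J₂ (ε * N) R (ε < 1 / 4) (fun i => h (w ω) (ξ i ω))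
        (∫ y, h (w ω) y ∂𝒟)} = (fun ω => (w ω, X ω)) ⁻¹' Aᶜ := rfl
  rw [hpre, ← Measure.map_apply (hw'.prodMk hX) hA.compl, hmap, hmapX,
    Measure.prod_apply hA.compl, lintegral_map (measurable_measure_prodMk_left hA.compl) hw']
  calc _ ≤ ∫⁻ _, ENNReal.ofReal (4 * Real.exp (-(ε * N / 4))) ∂P := by
        refine lintegral_mono fun ω => ?_
        have hb := pi_real_not_upperRegular_le (𝒟 := 𝒟) (h := h (w ω)) (σ := σ)
          (hm.comp measurable_prodMk_left) ((hL2 ω).integrable (by norm_num)) rfl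
          (((hL2 ω).sub (memLp_const _)).integrable_sq) (hvar ω) hR hε hσ hN J₁ J₂ h₁ h₁' h₂
        exact (ENNReal.le_ofReal_iff_toReal_le (measure_ne_top _ _) (by positivity)).2 hb
    _ = _ := by simp

/-- Regularity from both sides of fresh samples at a random point that is determined by the
past. -/
lemma measure_not_regular_le {Ξ : Type*} [MeasurableSpace Ξ] {𝒟 : Measure Ξ}
    [IsProbabilityMeasure 𝒟] {ι : Type*} [Fintype ι] {Ω : Type*} {m mΩ : MeasurableSpace Ω}
    {P : Measure Ω} [IsProbabilityMeasure P] (hle : m ≤ mΩ) {W : Type*} [MeasurableSpace W]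
    {w : Ω → W} (hw : Measurable[m] w) {ξ : ι → Ω → Ξ} (hξ : ∀ i, Measurable (ξ i))
    (hlaw : ∀ i, P.map (ξ i) = 𝒟) (hind : iIndepFun ξ P)
    (hpast : Indep (⨆ i, MeasurableSpace.comap (ξ i) inferInstance) m P)
    {h : W → Ξ → ℝ} (hm : Measurable (Function.uncurry h)) {σ R ε N : ℝ}
    (hL2 : ∀ ω, MemLp (h (w ω)) 2 𝒟)
    (hvar : ∀ ω, ∫ x, (h (w ω) x - ∫ y, h (w ω) y ∂𝒟) ^ 2 ∂𝒟 ≤ σ ^ 2)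
    (hR : 0 ≤ R) (hε : 0 < ε) (hσ : σ ^ 2 = R ^ 2 * (ε / 4)) (hN : 0 < N)
    (J₁ J₂ : Finset ι) (h₁ : J₁.card ≤ N) (h₁' : 7 / 8 * N ≤ J₁.card) (h₂ : J₂.card ≤ N) :
    P {ω | ¬ (UpperRegular J₁ J₂ (ε * N) R (ε < 1 / 4) (fun i => h (w ω) (ξ i ω))
          (∫ y, h (w ω) y ∂𝒟) ∧
        UpperRegular J₁ J₂ (ε * N) R (ε < 1 / 4) (fun i => -h (w ω) (ξ i ω))
          (-∫ y, h (w ω) y ∂𝒟))} ≤ ENNReal.ofReal (8 * Real.exp (-(ε * N / 4))) := by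
  have h1 := measure_not_upperRegular_le hle hw hξ hlaw hind hpast hm hL2 hvar hR hε hσ hN
    J₁ J₂ h₁ h₁' h₂
  have h2 := measure_not_upperRegular_le (h := fun w x => -h w x) hle hw hξ hlaw hind hpast hm.neg
    (fun ω => (hL2 ω).neg) (fun ω => by
      refine le_of_eq_of_le (integral_congr_ae (Filter.Eventually.of_forall fun x => ?_)) (hvar ω)
      simp only [integral_neg]; ring) hR hε hσ hN J₁ J₂ h₁ h₁' h₂
  simp only [integral_neg] at h2
  simp only [not_and_or, Set.ofPred_or]
  refine (measure_union_le _ _).trans ((add_le_add h1 h2).trans ?_)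
  rw [← ENNReal.ofReal_add (by positivity) (by positivity)]
  exact ENNReal.ofReal_le_ofReal (by linarith)

/-! ### Convexity, projections and the extra-gradient step -/

open scoped RealInnerProductSpace in
/-- The gradient inequality of a convex function that is differentiable within a convex set. -/
lemma inner_gradient_le_sub {E : Type*} [NormedAddCommGroup E] [InnerProductSpace ℝ E]
    [CompleteSpace E] {X : Set E} {f : E → ℝ} (hf : ConvexOn ℝ X f) {x y g : E} (hx : x ∈ X)
    (hy : y ∈ X) (hg : HasGradientWithinAt f g X x) : ⟪g, y - x⟫ ≤ f y - f x := by
  set l : ℝ →ᵃ[ℝ] E := AffineMap.lineMap x y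
  have hmaps : Set.MapsTo l (Set.Icc 0 1) X := fun t ht =>
    hf.1.segment_subset hx hy (by rw [segment_eq_image_lineMap]; exact ⟨t, ht, rfl⟩)
  have hconv : ConvexOn ℝ (Set.Icc (0 : ℝ) 1) (f ∘ l) :=
    (hf.comp_affineMap l).subset hmaps (convex_Icc 0 1)
  have hl : HasDerivWithinAt l (y - x) (Set.Icc 0 1) 0 := AffineMap.hasDerivWithinAt_lineMap
  have hl0 : l 0 = x := AffineMap.lineMap_apply_zero x y
  have hl1 : l 1 = y := AffineMap.lineMap_apply_one x y
  have hd : HasDerivWithinAt (f ∘ l) ⟪g, y - x⟫ (Set.Icc 0 1) 0 := by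
    have h1 := hg.hasFDerivWithinAt
    rw [← hl0] at h1
    simpa using h1.comp_hasDerivWithinAt (0 : ℝ) hl hmaps
  have := hconv.le_slope_of_hasDerivWithinAt (by simp) (by simp) zero_lt_one hd
  simpa [slope_def_field, hl0, hl1] using this

section

variable {n : ℕ} {X : Set (Vec n)}

lemma euclProj_spec (hX : IsCompact X) (hne : X.Nonempty) (v : Vec n) :
    euclProj X v ∈ X ∧ ∀ q ∈ X, ‖euclProj X v - v‖ ≤ ‖q - v‖ := by
  have : ∃ p, p ∈ X ∧ ∀ q ∈ X, ‖p - v‖ ≤ ‖q - v‖ := by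
    obtain ⟨p, hp, hmin⟩ := hX.exists_isMinOn hne
      (f := fun q => ‖q - v‖) (by fun_prop)
    exact ⟨p, hp, fun q hq => hmin hq⟩
  exact Classical.epsilon_spec this

open scoped RealInnerProductSpace in
/-- The variational inequality of the projection. -/
lemma inner_sub_euclProj_le (hc : Convex ℝ X) (hX : IsCompact X) (v : Vec n) {q : Vec n}
    (hq : q ∈ X) : ⟪v - euclProj X v, q - euclProj X v⟫ ≤ 0 := by
  obtain ⟨h1, h2⟩ := euclProj_spec hX ⟨q, hq⟩ v
  refine (norm_eq_iInf_iff_real_inner_le_zero hc h1).1 ?_ q hq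
  have : Nonempty X := ⟨⟨q, hq⟩⟩
  refine le_antisymm (le_ciInf fun w => ?_) ?_
  · rw [norm_sub_rev, norm_sub_rev v]; exact h2 w w.2
  · exact ciInf_le (f := fun w : X => ‖v - w‖) ⟨0, by rintro _ ⟨w, rfl⟩; exact norm_nonneg _⟩
      ⟨euclProj X v, h1⟩

/-- Adding the variational inequalities at two points shows that the projection is nonexpansive,
hence continuous; its definition by choice gives no measurability directly. -/
lemma measurable_euclProj (hc : Convex ℝ X) (hX : IsCompact X) (hne : X.Nonempty) :
    Measurable (euclProj X) := by
  have : LipschitzWith 1 (euclProj X) := by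
    refine LipschitzWith.of_dist_le_mul fun v w => ?_
    have h1 := inner_sub_euclProj_le hc hX v (euclProj_spec hX hne w).1
    have h2 := inner_sub_euclProj_le hc hX w (euclProj_spec hX hne v).1
    set p := euclProj X v
    set r := euclProj X w
    have h3 : ‖p - r‖ ^ 2 ≤ inner ℝ (v - w) (p - r) := by
      rw [← real_inner_self_eq_norm_sq]
      have : inner ℝ (v - p) (r - p) + inner ℝ (w - r) (p - r)
          = inner ℝ (p - r) (p - r) - inner ℝ (v - w) (p - r) := by
        rw [← neg_sub p r, inner_neg_right, ← inner_sub_left, ← sub_eq_neg_add, ← inner_sub_left]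
        congr 1
        abel
      linarith
    have h4 := h3.trans (real_inner_le_norm _ _)
    rw [dist_eq_norm, dist_eq_norm, NNReal.coe_one, one_mul]
    rcases (norm_nonneg (p - r)).eq_or_lt with h | h
    · rw [← h]; exact norm_nonneg _
    · rw [sq] at h4
      exact le_of_mul_le_mul_right h4 h
  exact this.continuous.measurable

end

open scoped RealInnerProductSpace in
/-- One extra-gradient step in one block of variables. -/
lemma inner_extragradient_le {E : Type*} [NormedAddCommGroup E] [InnerProductSpace ℝ E]
    {x xh xp q g gh : E} {η : ℝ} (h1 : ⟪x - η • g - xh, xp - xh⟫ ≤ 0)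
    (h2 : ⟪x - η • gh - xp, q - xp⟫ ≤ 0) :
    η * ⟪gh, xh - q⟫ ≤ (‖x - q‖ ^ 2 - ‖xp - q‖ ^ 2 - ‖x - xh‖ ^ 2 - ‖xh - xp‖ ^ 2) / 2
      + η * ⟪gh - g, xh - xp⟫ := by
  simp only [norm_sub_sq_real, inner_sub_left, inner_sub_right, real_inner_smul_left,
    real_inner_self_eq_norm_sq] at *
  rw [real_inner_comm xp xh] at *
  linarith

open scoped RealInnerProductSpace in
lemma inner_le_mul_of_norm_le {E : Type*} [NormedAddCommGroup E] [InnerProductSpace ℝ E]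
    {u w : E} {a b : ℝ} (hu : ‖u‖ ≤ a) (hw : ‖w‖ ≤ b) : ⟪u, w⟫ ≤ a * b :=
  (real_inner_le_norm u w).trans
    (mul_le_mul hu hw (norm_nonneg _) ((norm_nonneg _).trans hu))

open scoped RealInnerProductSpace in
/-- Progress of one inexact extra-gradient step. -/
lemma extragradient_step_le {E F : Type*} [NormedAddCommGroup E] [InnerProductSpace ℝ E]
    [NormedAddCommGroup F] [InnerProductSpace ℝ F] {x xh xp q g gh G Gh : E}
    {y yh yp r k kh K Kh : F} {η L e D : ℝ} (hη : 0 < η) (hηL : η * L ≤ 1 / 2)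
    (hx1 : ⟪x - η • g - xh, xp - xh⟫ ≤ 0) (hx2 : ⟪x - η • gh - xp, q - xp⟫ ≤ 0)
    (hy1 : ⟪y + η • k - yh, yp - yh⟫ ≤ 0) (hy2 : ⟪y + η • kh - yp, r - yp⟫ ≤ 0)
    (hg : ‖g - G‖ ≤ e) (hgh : ‖gh - Gh‖ ≤ e) (hk : ‖k - K‖ ≤ e) (hkh : ‖kh - Kh‖ ≤ e)
    (hG : ‖Gh - G‖ ≤ L * (‖x - xh‖ + ‖y - yh‖)) (hK : ‖Kh - K‖ ≤ L * (‖x - xh‖ + ‖y - yh‖))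
    (dx : ‖xh - xp‖ ≤ D) (dy : ‖yh - yp‖ ≤ D) (dq : ‖xh - q‖ ≤ D) (dr : ‖yh - r‖ ≤ D) :
    η * (⟪Gh, xh - q⟫ + ⟪Kh, r - yh⟫) ≤ ((‖x - q‖ ^ 2 + ‖y - r‖ ^ 2)
      - (‖xp - q‖ ^ 2 + ‖yp - r‖ ^ 2)) / 2 + η * (6 * e * D) := by
  have he : 0 ≤ e := (norm_nonneg _).trans hg
  have hx := inner_extragradient_le hx1 hx2
  -- Ascent along `k` is descent along `-k`.
  have hy := inner_extragradient_le (x := y) (xh := yh) (xp := yp) (q := r) (g := -k) (gh := -kh)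
    (η := η) (by simpa using hy1) (by simpa using hy2)
  have e1 : ⟪Gh, xh - q⟫ ≤ ⟪gh, xh - q⟫ + e * D := by
    have := inner_le_mul_of_norm_le (u := Gh - gh) (a := e) (by rwa [norm_sub_rev]) dq
    rw [inner_sub_left] at this
    linarith
  have e2 : ⟪Kh, r - yh⟫ ≤ ⟪-kh, yh - r⟫ + e * D := by
    have := inner_le_mul_of_norm_le (u := kh - Kh) hkh dr
    rw [inner_sub_left] at this
    rw [← neg_sub yh r, inner_neg_right, inner_neg_left]
    linarith
  set a := ‖x - xh‖
  set b := ‖y - yh‖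
  set c := ‖xh - xp‖
  set d := ‖yh - yp‖
  have ha : 0 ≤ a := norm_nonneg _
  have hb : 0 ≤ b := norm_nonneg _
  have hc : 0 ≤ c := norm_nonneg _
  have hd : 0 ≤ d := norm_nonneg _
  have e3 : ⟪gh - g, xh - xp⟫ ≤ (L * (a + b) + 2 * e) * c := by
    refine inner_le_mul_of_norm_le ?_ le_rfl
    have : gh - g = (gh - Gh) + (Gh - G) - (g - G) := by abel
    rw [this]
    linarith [norm_sub_le (gh - Gh + (Gh - G)) (g - G), norm_add_le (gh - Gh) (Gh - G)]
  have e4 : ⟪-kh - -k, yh - yp⟫ ≤ (L * (a + b) + 2 * e) * d := by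
    refine inner_le_mul_of_norm_le ?_ le_rfl
    have : -kh - -k = (k - K) - (kh - Kh) - (Kh - K) := by abel
    rw [this]
    linarith [norm_sub_le (k - K - (kh - Kh)) (Kh - K), norm_sub_le (k - K) (kh - Kh)]
  -- Smoothness contributes half of `(a + b) * (c + d)`, which the negative squares from the two
  -- blocks absorb.
  have e5 : η * L * ((a + b) * (c + d)) ≤ 1 / 2 * ((a + b) * (c + d)) :=
    mul_le_mul_of_nonneg_right hηL (by positivity)
  have e6 : (a + b) * (c + d) ≤ a ^ 2 + b ^ 2 + c ^ 2 + d ^ 2 := by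
    linarith only [sq_nonneg (a - c), sq_nonneg (a - d), sq_nonneg (b - c), sq_nonneg (b - d)]
  -- This part of the error is `4 e D`; passing from robust to true gradients in `e1` and `e2` adds
  -- `2 e D`.
  have e7 : η * (2 * e * (c + d)) ≤ η * (4 * e * D) := by
    refine mul_le_mul_of_nonneg_left ?_ hη.le
    have := mul_le_mul_of_nonneg_left (show c + d ≤ 2 * D by linarith only [dx, dy]) he
    linarith only [this]
  have f1 := mul_le_mul_of_nonneg_left e1 hη.le
  have f2 := mul_le_mul_of_nonneg_left e2 hη.le
  have f3 := mul_le_mul_of_nonneg_left e3 hη.le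
  have f4 := mul_le_mul_of_nonneg_left e4 hη.le
  have f34 : η * ((L * (a + b) + 2 * e) * c) + η * ((L * (a + b) + 2 * e) * d)
      = η * L * ((a + b) * (c + d)) + η * (2 * e * (c + d)) := by ring
  have f12 : η * (⟪gh, xh - q⟫ + e * D) + η * (⟪-kh, yh - r⟫ + e * D)
      = η * ⟪gh, xh - q⟫ + η * ⟪-kh, yh - r⟫ + η * (6 * e * D) - η * (4 * e * D) := by ring
  rw [mul_add]
  linarith only [f1, f2, f3, f4, f34, f12, hx, hy, e5, e6, e7]

/-- Telescoping a potential. -/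
lemma sum_le_of_step_le {T : ℕ} {φ Φ : ℕ → ℝ} {η c : ℝ}
    (h : ∀ t < T, η * φ t ≤ (Φ t - Φ (t + 1)) / 2 + η * c) (hΦ : 0 ≤ Φ T) :
    η * ∑ t ∈ Finset.range T, φ t ≤ Φ 0 / 2 + η * (T * c) := by
  have h1 : ∑ t ∈ Finset.range T, η * φ t
      ≤ ∑ t ∈ Finset.range T, ((Φ t - Φ (t + 1)) / 2 + η * c) :=
    Finset.sum_le_sum fun t ht => h t (Finset.mem_range.1 ht)
  rw [← Finset.mul_sum, Finset.sum_add_distrib, ← Finset.sum_div, Finset.sum_range_sub',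
    Finset.sum_const, Finset.card_range, nsmul_eq_mul] at h1
  linarith

/-- From a bound on the regret against every point to the accuracy of the averages. -/
lemma abs_average_sub_saddle_le {n m : ℕ} {X : Set (Vec n)} {Y : Set (Vec m)}
    {f : Vec n → Vec m → ℝ} (hf : IsConvexConcave X Y f) (hXc : Convex ℝ X) (hYc : Convex ℝ Y)
    {xs : Vec n} {ys : Vec m}
    (hs : IsSaddlePoint X Y f xs ys) {T : ℕ} (hT : 0 < T) {w : ℕ → Vec n × Vec m}
    (hx : ∀ t < T, (w t).1 ∈ X) (hy : ∀ t < T, (w t).2 ∈ Y) {b : ℝ}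
    (hb : ∀ q ∈ X, ∀ r ∈ Y,
      ∑ t ∈ Finset.range T, (f (w t).1 r - f q (w t).2) ≤ T * b) :
    |f ((1 / (T : ℝ)) • ∑ t ∈ Finset.range T, w t).1
        ((1 / (T : ℝ)) • ∑ t ∈ Finset.range T, w t).2 - f xs ys| ≤ b := by
  have hT' : (0 : ℝ) < T := by exact_mod_cast hT
  have hone : ∑ _t ∈ Finset.range T, (1 / (T : ℝ)) = 1 := by
    rw [Finset.sum_const, Finset.card_range, nsmul_eq_mul]; field_simp
  set wb := (1 / (T : ℝ)) • ∑ t ∈ Finset.range T, w t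
  have h1 : wb.1 = ∑ t ∈ Finset.range T, (1 / (T : ℝ)) • (w t).1 := by
    simp [wb, Prod.fst_sum, Finset.smul_sum]
  have h2 : wb.2 = ∑ t ∈ Finset.range T, (1 / (T : ℝ)) • (w t).2 := by
    simp [wb, Prod.snd_sum, Finset.smul_sum]
  have hwX : wb.1 ∈ X := by
    rw [h1]
    exact hXc.sum_mem (fun _ _ => by positivity) hone fun t ht => hx t (Finset.mem_range.1 ht)
  have hwY : wb.2 ∈ Y := by
    rw [h2]
    exact hYc.sum_mem (fun _ _ => by positivity) hone fun t ht => hy t (Finset.mem_range.1 ht)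
  have gap : ∀ q ∈ X, ∀ r ∈ Y, f wb.1 r - f q wb.2 ≤ b := by
    intro q hq r hr
    have c1 : f wb.1 r ≤ ∑ t ∈ Finset.range T, (1 / (T : ℝ)) • f (w t).1 r := by
      rw [h1]
      exact (hf.1 r hr).map_sum_le (fun _ _ => by positivity) hone
        fun t ht => hx t (Finset.mem_range.1 ht)
    have c2 : ∑ t ∈ Finset.range T, (1 / (T : ℝ)) • f q (w t).2 ≤ f q wb.2 := by
      rw [h2]
      exact (hf.2 q hq).le_map_sum (fun _ _ => by positivity) hone
        fun t ht => hy t (Finset.mem_range.1 ht)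
    rw [← Finset.smul_sum] at c1 c2
    have c3 := hb q hq r hr
    rw [Finset.sum_sub_distrib] at c3
    have c4 := mul_le_mul_of_nonneg_left c3 (show 0 ≤ 1 / (T : ℝ) by positivity)
    rw [← mul_assoc, one_div_mul_cancel hT'.ne', one_mul, mul_sub] at c4
    simp only [smul_eq_mul] at c1 c2
    linarith
  obtain ⟨hxs, hys, hsad⟩ := hs
  -- The comparators `(x̄, ys)` and `(xs, ȳ)` give the lower and the upper bound; they may depend on
  -- the run because the gap bound holds for all points.
  rw [abs_le]
  constructor
  · linarith [gap wb.1 hwX ys hys, (hsad wb.1 hwX ys hys).2]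
  · linarith [gap xs hxs wb.2 hwY, (hsad xs hxs wb.2 hwY).1]

/-! ### Accuracy of the coordinate-wise trimmed mean -/

lemma measurable_truncate {α : Type*} [MeasurableSpace α] {γ β x : α → ℝ} (hγ : Measurable γ)
    (hβ : Measurable β) (hx : Measurable x) : Measurable fun a => truncate (γ a) (β a) (x a) :=
  Measurable.ite (measurableSet_lt hβ hx) hβ (Measurable.ite (measurableSet_lt hx hγ) hγ hx)

lemma measurable_trimmedMean {M : ℕ} (α δ : ℝ) :
    Measurable fun z : Fin M → ℝ => trimmedMean α δ z := by
  have hZ : Measurable fun (z : Fin M → ℝ) (i : Fin (M / 2)) => z (firstHalf M i) :=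
    measurable_pi_lambda _ fun i => measurable_pi_apply (firstHalf M i)
  have hZ' : ∀ i : Fin (M / 2), Measurable fun z : Fin M → ℝ => z (secondHalf M i) :=
    fun i => measurable_pi_apply (secondHalf M i)
  exact Measurable.const_mul (Finset.measurable_sum _ fun i _ =>
    measurable_truncate ((measurable_orderStat _).comp hZ) ((measurable_orderStat _).comp hZ)
      (hZ' i)) _

lemma measurable_trim {Ω : Type*} [MeasurableSpace Ω] {n M : ℕ} (α δ : ℝ) {z : Ω → Fin M → Vec n}
    (hz : ∀ i, Measurable fun ω => z ω i) : Measurable fun ω => trim α δ (z ω) := by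
  have h : Measurable fun ω (j : Fin n) => trimmedMean α δ (fun i => z ω i j) := by
    refine measurable_pi_lambda _ fun j => ?_
    have hj : Measurable fun v : Vec n => v j := by fun_prop
    have : Measurable fun ω (i : Fin M) => z ω i j :=
      measurable_pi_lambda _ fun i => hj.comp (hz i)
    exact (measurable_trimmedMean α δ).comp this
  exact (WithLp.measurable_toLp 2 _).comp h

/-- The coordinate-wise trimmed mean of fresh samples, evaluated at a random point that is
determined by the past, is accurate up to a small probability. -/
lemma measure_not_norm_trim_sub_le {Ξ : Type*} [MeasurableSpace Ξ] {𝒟 : Measure Ξ}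
    [IsProbabilityMeasure 𝒟] {Ω : Type*} {m mΩ : MeasurableSpace Ω}
    {P : Measure Ω} [IsProbabilityMeasure P] (hle : m ≤ mΩ) {W : Type*} [MeasurableSpace W]
    {w : Ω → W} (hw : Measurable[m] w) {M : ℕ} (hM : Even M) (hM0 : 0 < M) {B : Finset (Fin M)}
    {ξ : Fin M → Ω → Ξ} (hξ : ∀ i ∉ B, Measurable (ξ i))
    (hlaw : ∀ i ∉ B, P.map (ξ i) = 𝒟) (hind : iIndepFun (fun i : {i // i ∉ B} => ξ i) P)
    (hpast : Indep (⨆ i : {i // i ∉ B}, MeasurableSpace.comap (ξ i) inferInstance) m P)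
    {n : ℕ} {g : W → Ξ → Vec n} (hg : Measurable (Function.uncurry g)) {G : W → Vec n}
    {σ : Fin n → ℝ} (hL2 : ∀ ω, MemLp (g (w ω)) 2 𝒟) (hmean : ∀ ω, ∫ x, g (w ω) x ∂𝒟 = G (w ω))
    (hvar : ∀ ω j, ∫ x, (g (w ω) x j - G (w ω) j) ^ 2 ∂𝒟 ≤ σ j ^ 2)
    {α δ : ℝ} (hε0 : 0 < trimLevel α δ M) (hε : trimLevel α δ M ≤ 1 / 2)
    (hB : (B.card : ℝ) ≤ trimLevel α δ M * (M / 2 : ℕ) / 4)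
    (hδ : 8 * Real.exp (-(trimLevel α δ M * (M / 2 : ℕ) / 4)) ≤ δ)
    {z : Ω → Fin M → Vec n} (hz : ∀ ω, ∀ i ∉ B, z ω i = g (w ω) (ξ i ω)) :
    P {ω | ¬ ‖trim α δ (z ω) - G (w ω)‖
        ≤ 68 * Real.sqrt (trimLevel α δ M) * Real.sqrt (∑ j, σ j ^ 2)}
      ≤ n * ENNReal.ofReal δ := by
  set ε := trimLevel α δ M with hεdef
  set N : ℝ := ((M / 2 : ℕ) : ℝ) with hN
  have hN0 : 0 < N := by
    obtain ⟨r, hr⟩ := hM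
    rw [hN]
    exact_mod_cast (by omega : 0 < M / 2)
  -- Solves `σ j ^ 2 = R j ^ 2 * (ε / 4)`; the error `34 R ε` becomes `68 √ε |σ j|`.
  set R : Fin n → ℝ := fun j => 2 * |σ j| / Real.sqrt ε with hR
  have hR0 : ∀ j, 0 ≤ R j := fun j => by positivity
  have hsq : Real.sqrt ε ^ 2 = ε := Real.sq_sqrt hε0.le
  have hs0 : 0 < Real.sqrt ε := Real.sqrt_pos.2 hε0
  have hRσ : ∀ j, σ j ^ 2 = R j ^ 2 * (ε / 4) := fun j => by
    simp only [hR]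
    rw [div_pow, mul_pow, sq_abs, hsq]
    field_simp
    norm_num
  set J₁' := normalPart B (firstHalf M) with hJ₁'
  set J₂' := normalPart B (secondHalf M) with hJ₂'
  set J₁ : Finset {i // i ∉ B} := J₁'.subtype (fun i => i ∉ B) with hJ₁
  set J₂ : Finset {i // i ∉ B} := J₂'.subtype (fun i => i ∉ B) with hJ₂
  have hm₁ : J₁.map (Function.Embedding.subtype _) = J₁' := by
    rw [hJ₁, Finset.subtype_map]
    exact Finset.filter_true_of_mem fun i hi => (Finset.mem_sdiff.1 hi).2
  have hm₂ : J₂.map (Function.Embedding.subtype _) = J₂' := by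
    rw [hJ₂, Finset.subtype_map]
    exact Finset.filter_true_of_mem fun i hi => (Finset.mem_sdiff.1 hi).2
  have hc₁ : J₁.card = J₁'.card := by rw [← hm₁, Finset.card_map]
  have hc₂ : J₂.card = J₂'.card := by rw [← hm₂, Finset.card_map]
  have b₁ : (J₁.card : ℝ) ≤ N := by
    have := card_normalPart_le B (firstHalf M)
    rw [Fintype.card_fin] at this
    rw [hc₁]; exact Nat.cast_le.2 this
  have b₂ : (J₂.card : ℝ) ≤ N := by
    have := card_normalPart_le B (secondHalf M)
    rw [Fintype.card_fin] at this
    rw [hc₂]; exact Nat.cast_le.2 this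
  -- As `ε ≤ 1 / 2`, at most `ε N / 4 ≤ N / 8` agents are Byzantine.
  have b₁' : 7 / 8 * N ≤ J₁.card := by
    have := le_card_normalPart B (firstHalf M)
    rw [Fintype.card_fin] at this
    have h2 : N ≤ (J₁'.card : ℝ) + B.card := by rw [hN]; exact_mod_cast this
    rw [hc₁]
    nlinarith
  set Good : Fin n → Ω → Prop := fun j ω =>
    UpperRegular J₁ J₂ (ε * N) (R j) (ε < 1 / 4) (fun i => g (w ω) (ξ i ω) j)
          (∫ y, g (w ω) y j ∂𝒟) ∧
        UpperRegular J₁ J₂ (ε * N) (R j) (ε < 1 / 4) (fun i => -g (w ω) (ξ i ω) j)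
          (-∫ y, g (w ω) y j ∂𝒟) with hGood
  have hcoord : ∀ ω j, ∫ y, g (w ω) y j ∂𝒟 = G (w ω) j := fun ω j => by
    rw [← hmean ω]
    exact (EuclideanSpace.proj (𝕜 := ℝ) j).integral_comp_comm
      ((hL2 ω).integrable (by norm_num))
  have hbad : ∀ j, P {ω | ¬ Good j ω} ≤ ENNReal.ofReal δ := fun j => by
    have hj : Measurable fun v : Vec n => v j := by fun_prop
    refine (measure_not_regular_le (h := fun w x => g w x j) (σ := σ j) hle hw
      (fun i : {i // i ∉ B} => hξ i i.2)
      (fun i : {i // i ∉ B} => hlaw i i.2) hind hpast (hj.comp hg) (fun ω => ?_) (fun ω => ?_)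
      (hR0 j) hε0 (hRσ j) hN0 J₁ J₂ b₁ b₁' b₂).trans (ENNReal.ofReal_le_ofReal hδ)
    · exact (hL2 ω).continuousLinearMap_comp (EuclideanSpace.proj (𝕜 := ℝ) j)
    · simp only [hcoord]
      exact hvar ω j
  have hsub : {ω | ¬ ‖trim α δ (z ω) - G (w ω)‖ ≤ 68 * Real.sqrt ε * Real.sqrt (∑ j, σ j ^ 2)}
      ⊆ ⋃ j, {ω | ¬ Good j ω} := by
    intro ω hω
    by_contra hc
    simp only [Set.mem_iUnion, Set.mem_ofPred_eq, not_exists, not_not] at hc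
    refine hω ?_
    have hcoordle : ∀ j, |trimmedMean α δ (fun i => z ω i j) - G (w ω) j|
        ≤ 68 * Real.sqrt ε * |σ j| := fun j => by
      have h1 := hc j
      simp only [hGood, hcoord] at h1
      have h2 := abs_trimmedMean_sub_le hM hM0 B (fun i => z ω i j)
        (fun i => g (w ω) (ξ i ω) j) (fun i hi => by rw [hz ω i hi]) (α := α) (δ := δ)
        (μ := G (w ω) j) (R := R j) (hR0 j) hε0 hε hB
        (by rw [← hJ₁', ← hJ₂', ← hm₁, ← hm₂, upperRegular_map]; exact h1.1)
        (by rw [← hJ₁', ← hJ₂', ← hm₁, ← hm₂, upperRegular_map]; exact h1.2)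
      refine h2.trans_eq ?_
      rw [← hεdef]
      simp only [hR]
      nth_rewrite 2 [← hsq]
      field_simp
      ring
    rw [EuclideanSpace.norm_eq]
    have hnn : 0 ≤ 68 * Real.sqrt ε := by positivity
    rw [← Real.sqrt_sq hnn, ← Real.sqrt_mul (sq_nonneg _), Finset.mul_sum]
    refine Real.sqrt_le_sqrt (Finset.sum_le_sum fun j _ => ?_)
    rw [← sq_abs (σ j), ← mul_pow]
    exact pow_le_pow_left₀ (norm_nonneg _) (hcoordle j) 2
  refine (measure_mono hsub).trans ((measure_iUnion_le _).trans ?_)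
  rw [tsum_fintype]
  refine (Finset.sum_le_sum fun j _ => hbad j).trans ?_
  simp

/-! ### Runs of the algorithm: feasibility, measurability, accuracy -/

namespace RDEG

variable {n m M : ℕ} {Ξ : Type u} (S : RDEG n m M Ξ)

lemma step_mem (hX : IsCompact S.X) (hY : IsCompact S.Y) (hX0 : S.X.Nonempty)
    (hY0 : S.Y.Nonempty) (z : Vec n × Vec m) (hx : Vec n) (hy : Vec m) :
    S.step z hx hy ∈ S.X ×ˢ S.Y :=
  ⟨(euclProj_spec hX hX0 _).1, (euclProj_spec hY hY0 _).1⟩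

lemma iter_mem (hX : IsCompact S.X) (hY : IsCompact S.Y) (hx₁ : S.x₁ ∈ S.X) (hy₁ : S.y₁ ∈ S.Y)
    (s : ℕ → Fin M → Ξ) (ax : ℕ → Fin M → Vec n) (ay : ℕ → Fin M → Vec m) (t : ℕ) :
    S.iter s ax ay t ∈ S.X ×ˢ S.Y := by
  cases t with
  | zero => exact ⟨hx₁, hy₁⟩
  | succ t => exact S.step_mem hX hY ⟨_, hx₁⟩ ⟨_, hy₁⟩ _ _ _

lemma midIter_mem (hX : IsCompact S.X) (hY : IsCompact S.Y) (hx₁ : S.x₁ ∈ S.X) (hy₁ : S.y₁ ∈ S.Y)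
    (s : ℕ → Fin M → Ξ) (ax : ℕ → Fin M → Vec n) (ay : ℕ → Fin M → Vec m) (t : ℕ) :
    S.midIter s ax ay t ∈ S.X ×ˢ S.Y :=
  S.step_mem hX hY ⟨_, hx₁⟩ ⟨_, hy₁⟩ _ _ _

section Measurability

variable {Ω : Type*} {mΩ : MeasurableSpace Ω} {w : Ω → Vec n × Vec m}
  {s : Ω → Fin M → Ξ} {ax : Ω → Fin M → Vec n} {ay : Ω → Fin M → Vec m}

lemma measurable_step (hXc : Convex ℝ S.X) (hX : IsCompact S.X) (hX0 : S.X.Nonempty)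
    (hYc : Convex ℝ S.Y) (hY : IsCompact S.Y) (hY0 : S.Y.Nonempty) {hx : Ω → Vec n}
    {hy : Ω → Vec m} (hw : Measurable w) (hhx : Measurable hx) (hhy : Measurable hy) :
    Measurable fun ω => S.step (w ω) (hx ω) (hy ω) :=
  ((measurable_euclProj hXc hX hX0).comp (hw.fst.sub (hhx.const_smul S.η))).prodMk
    ((measurable_euclProj hYc hY hY0).comp (hw.snd.add (hhy.const_smul S.η)))

variable [MeasurableSpace Ξ]

lemma measurable_robustX (hg : Measurable fun p : (Vec n × Vec m) × Ξ => S.gx p.1.1 p.1.2 p.2)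
    (hw : Measurable w) (hs : ∀ i ∉ S.B, Measurable fun ω => s ω i)
    (ha : ∀ i ∈ S.B, Measurable fun ω => ax ω i) :
    Measurable fun ω => S.robustX (w ω) (s ω) (ax ω) := by
  refine measurable_trim S.α S.δ fun i => ?_
  by_cases hi : i ∈ S.B
  · simpa [hi] using ha i hi
  · simpa [hi, Function.comp_def] using hg.comp (hw.prodMk (hs i hi))

lemma measurable_robustY (hg : Measurable fun p : (Vec n × Vec m) × Ξ => S.gy p.1.1 p.1.2 p.2)
    (hw : Measurable w) (hs : ∀ i ∉ S.B, Measurable fun ω => s ω i)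
    (ha : ∀ i ∈ S.B, Measurable fun ω => ay ω i) :
    Measurable fun ω => S.robustY (w ω) (s ω) (ay ω) := by
  refine measurable_trim S.α S.δ fun i => ?_
  by_cases hi : i ∈ S.B
  · simpa [hi] using ha i hi
  · simpa [hi, Function.comp_def] using hg.comp (hw.prodMk (hs i hi))

end Measurability

end RDEG

namespace RDEG

variable {n m M : ℕ} {Ξ : Type u} (S : RDEG n m M Ξ)

/-- The iterates and the mid-points are determined by the past. -/
lemma measurable_iter [MeasurableSpace Ξ] {Ω : Type v} {mΩ : MeasurableSpace Ω} {P : Measure Ω}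
    {ℱ : Filtration ℕ mΩ} {𝒟 : Measure Ξ} {K : ℕ} {ξ : ℕ → Fin M → Ω → Ξ}
    {ax : ℕ → Fin M → Ω → Vec n} {ay : ℕ → Fin M → Ω → Vec m}
    (hXc : Convex ℝ S.X) (hX : IsCompact S.X) (hX0 : S.X.Nonempty)
    (hYc : Convex ℝ S.Y) (hY : IsCompact S.Y) (hY0 : S.Y.Nonempty)
    (hgx : Measurable fun p : (Vec n × Vec m) × Ξ => S.gx p.1.1 p.1.2 p.2)
    (hgy : Measurable fun p : (Vec n × Vec m) × Ξ => S.gy p.1.1 p.1.2 p.2)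
    (hB : IsByzantineModel P ℱ 𝒟 S.B K ξ ax ay) (t : ℕ) :
    (2 * t ≤ K → Measurable[ℱ (2 * t)] fun ω => S.iter (fun k i => ξ k i ω) (fun k i => ax k i ω)
      (fun k i => ay k i ω) t) ∧
    (2 * t < K → Measurable[ℱ (2 * t + 1)] fun ω => S.midIter (fun k i => ξ k i ω)
      (fun k i => ax k i ω) (fun k i => ay k i ω) t) := by
  have hstep : ∀ k < K, ∀ {w z : Ω → Vec n × Vec m}, Measurable[ℱ (k + 1)] w →
      Measurable[ℱ (k + 1)] z → Measurable[ℱ (k + 1)] fun ω => S.step (z ω)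
        (S.robustX (w ω) (fun i => ξ k i ω) (fun i => ax k i ω))
        (S.robustY (w ω) (fun i => ξ k i ω) (fun i => ay k i ω)) := by
    intro k hk w z hw hz
    exact S.measurable_step hXc hX hX0 hYc hY hY0 hz
      (S.measurable_robustX hgx hw (hB.sample_adapted k hk) (hB.message_x k hk))
      (S.measurable_robustY hgy hw (hB.sample_adapted k hk) (hB.message_y k hk))
  have hmid : ∀ t, 2 * t < K → (Measurable[ℱ (2 * t)] fun ω => S.iter (fun k i => ξ k i ω)
      (fun k i => ax k i ω) (fun k i => ay k i ω) t) →
      Measurable[ℱ (2 * t + 1)] fun ω => S.midIter (fun k i => ξ k i ω)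
      (fun k i => ax k i ω) (fun k i => ay k i ω) t := by
    intro t ht h
    have h' := h.mono (ℱ.mono (Nat.le_succ (2 * t))) le_rfl
    exact hstep (2 * t) ht h' h'
  have hiter : 2 * t ≤ K → Measurable[ℱ (2 * t)] fun ω => S.iter (fun k i => ξ k i ω)
      (fun k i => ax k i ω) (fun k i => ay k i ω) t := by
    induction t with
    | zero => exact fun _ => measurable_const
    | succ t ih =>
      intro ht
      have h1 := ih (by omega)
      have h2 := hmid t (by omega) h1
      have h3 := hstep (2 * t + 1) (by omega) (h2.mono (ℱ.mono (Nat.le_succ _)) le_rfl)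
        (h1.mono (ℱ.mono (by omega)) le_rfl)
      exact h3
  exact ⟨hiter, fun ht => hmid t ht (hiter ht.le)⟩

open scoped RealInnerProductSpace in
/-- Accuracy of the averages on a run whose robust gradients have errors at most `e`. -/
lemma abs_average_sub_le {f : Vec n → Vec m → ℝ} {Gx : Vec n → Vec m → Vec n}
    {Gy : Vec n → Vec m → Vec m} {L e : ℝ} {xs : Vec n} {ys : Vec m}
    (hXc : Convex ℝ S.X) (hX : IsCompact S.X) (hYc : Convex ℝ S.Y) (hY : IsCompact S.Y)
    (hG : IsPartialGradient S.X S.Y f Gx Gy) (hf : IsConvexConcave S.X S.Y f)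
    (hs : IsSaddlePoint S.X S.Y f xs ys) (hL : 0 < L) (hsm : IsSmooth S.X S.Y L Gx Gy)
    (hx₁ : S.x₁ ∈ S.X) (hy₁ : S.y₁ ∈ S.Y) (hη : 0 < S.η) (hηL : S.η ≤ 1 / (2 * L))
    {T : ℕ} (hT : 0 < T)
    (s : ℕ → Fin M → Ξ) (ax : ℕ → Fin M → Vec n) (ay : ℕ → Fin M → Vec m)
    (he : ∀ t < T,
      (‖S.robustX (S.iter s ax ay t) (s (2 * t)) (ax (2 * t))
          - Gx (S.iter s ax ay t).1 (S.iter s ax ay t).2‖ ≤ e ∧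
        ‖S.robustY (S.iter s ax ay t) (s (2 * t)) (ay (2 * t))
          - Gy (S.iter s ax ay t).1 (S.iter s ax ay t).2‖ ≤ e) ∧
      (‖S.robustX (S.midIter s ax ay t) (s (2 * t + 1)) (ax (2 * t + 1))
          - Gx (S.midIter s ax ay t).1 (S.midIter s ax ay t).2‖ ≤ e ∧
        ‖S.robustY (S.midIter s ax ay t) (s (2 * t + 1)) (ay (2 * t + 1))
          - Gy (S.midIter s ax ay t).1 (S.midIter s ax ay t).2‖ ≤ e)) :
    |f (S.average s ax ay T).1 (S.average s ax ay T).2 - f xs ys|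
      ≤ max (Metric.diam S.X) (Metric.diam S.Y) ^ 2 / (S.η * T)
        + 6 * e * max (Metric.diam S.X) (Metric.diam S.Y) := by
  set D := max (Metric.diam S.X) (Metric.diam S.Y)
  have hT' : (0 : ℝ) < T := by exact_mod_cast hT
  have hD0 : 0 ≤ D := Metric.diam_nonneg.trans (le_max_left _ _)
  have hDX : ∀ a ∈ S.X, ∀ b ∈ S.X, ‖a - b‖ ≤ D := fun a ha b hb => by
    rw [← dist_eq_norm]
    exact (Metric.dist_le_diam_of_mem hX.isBounded ha hb).trans (le_max_left _ _)
  have hDY : ∀ a ∈ S.Y, ∀ b ∈ S.Y, ‖a - b‖ ≤ D := fun a ha b hb => by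
    rw [← dist_eq_norm]
    exact (Metric.dist_le_diam_of_mem hY.isBounded ha hb).trans (le_max_right _ _)
  have hiter := S.iter_mem hX hY hx₁ hy₁ s ax ay
  have hmid := S.midIter_mem hX hY hx₁ hy₁ s ax ay
  have hηL' : S.η * L ≤ 1 / 2 := by
    have := mul_le_mul_of_nonneg_right hηL hL.le
    refine this.trans_eq ?_
    field_simp
  refine abs_average_sub_saddle_le hf hXc hYc hs hT (fun t _ => (hmid t).1) (fun t _ => (hmid t).2)
    fun q hq r hr => ?_
  set Φ : ℕ → ℝ := fun t => ‖(S.iter s ax ay t).1 - q‖ ^ 2 + ‖(S.iter s ax ay t).2 - r‖ ^ 2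
    with hΦ
  have key := sum_le_of_step_le (T := T) (Φ := Φ) (η := S.η) (c := 6 * e * D)
    (φ := fun t => f (S.midIter s ax ay t).1 r - f q (S.midIter s ax ay t).2) (fun t ht => ?_)
    (by positivity)
  -- Each block contributes at most `D ^ 2`; half of the initial potential gives the term `D ^ 2 /
  -- (η T)`.
  · have hΦ0 : Φ 0 ≤ 2 * D ^ 2 := by
      have h1 := pow_le_pow_left₀ (norm_nonneg _) (hDX _ hx₁ q hq) 2
      have h2 := pow_le_pow_left₀ (norm_nonneg _) (hDY _ hy₁ r hr) 2
      have : Φ 0 = ‖S.x₁ - q‖ ^ 2 + ‖S.y₁ - r‖ ^ 2 := rfl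
      linarith
    refine le_of_mul_le_mul_left ?_ hη
    refine key.trans ?_
    have : S.η * (T * (D ^ 2 / (S.η * T) + 6 * e * D)) = D ^ 2 + S.η * (T * (6 * e * D)) := by
      field_simp
    rw [this]
    linarith
  · obtain ⟨⟨he1, he2⟩, he3, he4⟩ := he t ht
    have hz := hiter t
    have hw := hmid t
    have hp := hiter (t + 1)
    have hwdef : S.midIter s ax ay t = S.step (S.iter s ax ay t)
      (S.robustX (S.iter s ax ay t) (s (2 * t)) (ax (2 * t)))
      (S.robustY (S.iter s ax ay t) (s (2 * t)) (ay (2 * t))) := rfl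
    have hpdef : S.iter s ax ay (t + 1) = S.step (S.iter s ax ay t)
      (S.robustX (S.midIter s ax ay t) (s (2 * t + 1)) (ax (2 * t + 1)))
      (S.robustY (S.midIter s ax ay t) (s (2 * t + 1)) (ay (2 * t + 1))) := rfl
    simp only [hΦ]
    generalize S.robustX (S.iter s ax ay t) (s (2 * t)) (ax (2 * t)) = g at *
    generalize S.robustY (S.iter s ax ay t) (s (2 * t)) (ay (2 * t)) = k at *
    generalize S.robustX (S.midIter s ax ay t) (s (2 * t + 1)) (ax (2 * t + 1)) = gh at *
    generalize S.robustY (S.midIter s ax ay t) (s (2 * t + 1)) (ay (2 * t + 1)) = kh at *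
    generalize S.iter s ax ay t = z at *
    generalize S.midIter s ax ay t = w at *
    generalize S.iter s ax ay (t + 1) = p at *
    have hw1 : w.1 = euclProj S.X (z.1 - S.η • g) := by rw [hwdef]; rfl
    have hw2 : w.2 = euclProj S.Y (z.2 + S.η • k) := by rw [hwdef]; rfl
    have hp1 : p.1 = euclProj S.X (z.1 - S.η • gh) := by rw [hpdef]; rfl
    have hp2 : p.2 = euclProj S.Y (z.2 + S.η • kh) := by rw [hpdef]; rfl
    have hsmooth := hsm w.1 hw.1 z.1 hz.1 w.2 hw.2 z.2 hz.2
    rw [norm_sub_rev w.1, norm_sub_rev w.2] at hsmooth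
    have hstep := extragradient_step_le (x := z.1) (xh := w.1) (xp := p.1) (q := q) (y := z.2)
      (yh := w.2) (yp := p.2) (r := r) (g := g) (gh := gh) (k := k) (kh := kh) hη hηL'
      (by rw [hw1]; exact inner_sub_euclProj_le hXc hX _ hp.1)
      (by rw [hp1]; exact inner_sub_euclProj_le hXc hX _ hq)
      (by rw [hw2]; exact inner_sub_euclProj_le hYc hY _ hp.2)
      (by rw [hp2]; exact inner_sub_euclProj_le hYc hY _ hr)
      he1 he3 he2 he4 hsmooth.1 hsmooth.2 (hDX _ hw.1 _ hp.1) (hDY _ hw.2 _ hp.2)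
      (hDX _ hw.1 _ hq) (hDY _ hw.2 _ hr)
    refine le_trans (mul_le_mul_of_nonneg_left ?_ hη.le) hstep
    have c1 := inner_gradient_le_sub (hf.1 w.2 hw.2) hw.1 hq (hG.grad_x w.1 hw.1 w.2 hw.2)
    have hneg : HasGradientWithinAt (-fun y' => f w.1 y') (-Gy w.1 w.2) S.Y w.2 := by
      rw [hasGradientWithinAt_iff_hasFDerivWithinAt, map_neg]
      exact (hG.grad_y w.1 hw.1 w.2 hw.2).hasFDerivWithinAt.neg
    have c2 := inner_gradient_le_sub (hf.2 w.1 hw.1).neg hw.2 hr hneg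
    rw [inner_neg_left] at c2
    rw [← neg_sub w.1 q, inner_neg_right] at c1
    simp only [Pi.neg_apply] at c2
    linarith

end RDEG

/-! ### Choice of parameters and union bound -/

/-- Consequences of the choice of the parameters for the trimming level. -/
lemma trimLevel_bounds {d T M : ℕ} {α δ : ℝ} (hd : 0 < d) (hT : 0 < T) (hM : Even M) (hM0 : 0 < M)
    (hα : 0 ≤ α) (hδ : δ = 1 / (4 * d * (T : ℝ) ^ 2)) :
    0 < trimLevel α δ M ∧ 8 * α ≤ trimLevel α δ M ∧
    8 * Real.exp (-(trimLevel α δ M * (M / 2 : ℕ) / 4)) ≤ δ ∧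
    Real.sqrt (trimLevel α δ M)
      ≤ 7 * (Real.sqrt α + Real.sqrt (Real.log (4 * d * (T : ℝ) ^ 2) / M)) := by
  have hd' : (1 : ℝ) ≤ d := by exact_mod_cast hd
  have hT' : (1 : ℝ) ≤ T := by exact_mod_cast hT
  have hM' : (0 : ℝ) < M := by exact_mod_cast hM0
  have hMN : (M : ℝ) = 2 * (M / 2 : ℕ) := by
    obtain ⟨r, hr⟩ := hM
    have : M = 2 * (M / 2) := by omega
    exact_mod_cast this
  set u : ℝ := 4 * d * (T : ℝ) ^ 2 with hu
  have hu4 : 4 ≤ u := by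
    have h1 : (1 : ℝ) ≤ (T : ℝ) ^ 2 := one_le_pow₀ hT'
    nlinarith
  have hδ0 : 0 < δ := by rw [hδ]; positivity
  have hlog0 : 0 < Real.log u := Real.log_pos (by linarith)
  have hlog4 : Real.log (4 / δ) = Real.log 4 + Real.log u := by
    rw [hδ, div_div_eq_mul_div, div_one, Real.log_mul (by norm_num) (by linarith)]
  have hl4 : Real.log 4 ≤ Real.log u := Real.log_le_log (by norm_num) hu4
  have hl40 : 0 < Real.log 4 := Real.log_pos (by norm_num)
  set l := Real.log (4 / δ) with hl
  have hε : trimLevel α δ M = 8 * α + 24 * (l / M) := rfl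
  have hlM : 0 < l / M := div_pos (by linarith) hM'
  refine ⟨by rw [hε]; linarith, by rw [hε]; linarith, ?_, ?_⟩
  -- The summand `24 l / M` of the level, times `M / 8`, is `3 l`; so the failure probability is at
  -- most `8 (δ / 4) ^ 3 ≤ δ`.
  · have h1 : 3 * l ≤ trimLevel α δ M * (M / 2 : ℕ) / 4 := by
      have : l / M * (M / 2 : ℕ) = l / 2 := by
        have h0 : ((M / 2 : ℕ) : ℝ) ≠ 0 := by
          intro h; rw [h] at hMN; linarith
        rw [hMN]; field_simp
      rw [hε]
      have h2 : 0 ≤ α * (M / 2 : ℕ) := by positivity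
      nlinarith
    have h2 : Real.exp (-(trimLevel α δ M * (M / 2 : ℕ) / 4)) ≤ (δ / 4) ^ 3 := by
      have : (δ / 4) ^ 3 = Real.exp (-(3 * l)) := by
        rw [← mul_neg, hl, ← Real.log_inv, inv_div]
        have := Real.exp_nat_mul (Real.log (δ / 4)) 3
        rw [Real.exp_log (by positivity)] at this
        exact_mod_cast this.symm
      rw [this]
      exact Real.exp_le_exp.2 (by linarith)
    have hδ1 : δ ≤ 1 := by
      rw [hδ, div_le_one (by linarith)]; linarith
    have h3 : δ ^ 3 ≤ δ := by
      have := pow_le_pow_of_le_one hδ0.le hδ1 (show 1 ≤ 3 by norm_num)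
      simpa using this
    nlinarith
  -- Since `4 ≤ u`, `l ≤ 2 log u`; the level is then at most `8 α + 48 log u / M`, and `48 ≤ 7 ^ 2`.
  · rw [Real.sqrt_le_left (by positivity)]
    have h1 := Real.sq_sqrt hα
    have h2 := Real.sq_sqrt (show 0 ≤ Real.log u / M by positivity)
    have h3 : l / M ≤ 2 * (Real.log u / M) := by
      rw [← mul_div_assoc]
      exact div_le_div_of_nonneg_right (by linarith) hM'.le
    rw [hε]
    have h4 : 0 ≤ Real.sqrt α * Real.sqrt (Real.log u / M) := by positivity
    nlinarith

/-- One communication phase: both robust gradients are accurate with high probability. -/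
lemma measure_phase_error_le {n m M : ℕ} {Ξ : Type u} [MeasurableSpace Ξ] {𝒟 : Measure Ξ}
    [IsProbabilityMeasure 𝒟] {Ω : Type v} {mΩ : MeasurableSpace Ω} {P : Measure Ω}
    [IsProbabilityMeasure P] {ℱ : Filtration ℕ mΩ} (S : RDEG n m M Ξ)
    {Gx : Vec n → Vec m → Vec n} {Gy : Vec n → Vec m → Vec m} {σx : Fin n → ℝ} {σy : Fin m → ℝ}
    {K : ℕ} {ξ : ℕ → Fin M → Ω → Ξ} {ax : ℕ → Fin M → Ω → Vec n} {ay : ℕ → Fin M → Ω → Vec m}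
    (hO : IsOracle 𝒟 S.X S.Y Gx Gy S.gx S.gy σx σy)
    (hBm : IsByzantineModel P ℱ 𝒟 S.B K ξ ax ay) (hM : Even M) (hM0 : 0 < M)
    (hε0 : 0 < trimLevel S.α S.δ M) (hε : trimLevel S.α S.δ M ≤ 1 / 2)
    (hB : (S.B.card : ℝ) ≤ trimLevel S.α S.δ M * (M / 2 : ℕ) / 4)
    (hδ : 8 * Real.exp (-(trimLevel S.α S.δ M * (M / 2 : ℕ) / 4)) ≤ S.δ)
    {k : ℕ} (hk : k < K) {w : Ω → Vec n × Vec m} (hw : Measurable[ℱ k] w)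
    (hwXY : ∀ ω, w ω ∈ S.X ×ˢ S.Y) {e : ℝ}
    (he : 68 * Real.sqrt (trimLevel S.α S.δ M) * noiseLevel σx σy ≤ e) :
    P {ω | ¬ (‖S.robustX (w ω) (fun i => ξ k i ω) (fun i => ax k i ω)
          - Gx (w ω).1 (w ω).2‖ ≤ e ∧
        ‖S.robustY (w ω) (fun i => ξ k i ω) (fun i => ay k i ω) - Gy (w ω).1 (w ω).2‖ ≤ e)}
      ≤ (n + m) * ENNReal.ofReal S.δ := by
  have hξ : ∀ i ∉ S.B, Measurable (ξ k i) := fun i hi =>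
    (hBm.sample_adapted k hk i hi).mono (ℱ.le _) le_rfl
  have h1 := measure_not_norm_trim_sub_le (ℱ.le k) hw hM hM0 hξ (hBm.sample_law k hk)
    (hBm.sample_indep k hk) (hBm.sample_indep_past k hk) (g := fun w => S.gx w.1 w.2)
    (G := fun w => Gx w.1 w.2) (σ := σx) hO.measurable_x
    (fun ω => hO.memLp_x _ (hwXY ω).1 _ (hwXY ω).2) (fun ω => hO.mean_x _ (hwXY ω).1 _ (hwXY ω).2)
    (fun ω => hO.var_x _ (hwXY ω).1 _ (hwXY ω).2) hε0 hε hB hδ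
    (z := fun ω i => if i ∈ S.B then ax k i ω else S.gx (w ω).1 (w ω).2 (ξ k i ω))
    (fun ω i hi => by simp [hi])
  have h2 := measure_not_norm_trim_sub_le (ℱ.le k) hw hM hM0 hξ (hBm.sample_law k hk)
    (hBm.sample_indep k hk) (hBm.sample_indep_past k hk) (g := fun w => S.gy w.1 w.2)
    (G := fun w => Gy w.1 w.2) (σ := σy) hO.measurable_y
    (fun ω => hO.memLp_y _ (hwXY ω).1 _ (hwXY ω).2) (fun ω => hO.mean_y _ (hwXY ω).1 _ (hwXY ω).2)
    (fun ω => hO.var_y _ (hwXY ω).1 _ (hwXY ω).2) hε0 hε hB hδ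
    (z := fun ω i => if i ∈ S.B then ay k i ω else S.gy (w ω).1 (w ω).2 (ξ k i ω))
    (fun ω i hi => by simp [hi])
  have hnn : 0 ≤ 68 * Real.sqrt (trimLevel S.α S.δ M) := by positivity
  have e1 : 68 * Real.sqrt (trimLevel S.α S.δ M) * Real.sqrt (∑ j, σx j ^ 2) ≤ e :=
    (mul_le_mul_of_nonneg_left (le_max_left _ _) hnn).trans he
  have e2 : 68 * Real.sqrt (trimLevel S.α S.δ M) * Real.sqrt (∑ j, σy j ^ 2) ≤ e :=
    (mul_le_mul_of_nonneg_left (le_max_right _ _) hnn).trans he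
  rw [add_mul]
  refine (measure_mono ?_).trans ((measure_union_le _ _).trans (add_le_add h1 h2))
  intro ω hω
  rcases not_and_or.1 hω with h | h
  · exact Or.inl fun h' => h (h'.trans e1)
  · exact Or.inr fun h' => h (h'.trans e2)

theorem corollary1 :
    ∃ C : ℝ, 0 < C ∧
      ∀ (n m M T : ℕ) (Ξ : Type u) [MeasurableSpace Ξ] (𝒟 : Measure Ξ) [IsProbabilityMeasure 𝒟]
        (Ω : Type v) [mΩ : MeasurableSpace Ω] (P : Measure Ω) [IsProbabilityMeasure P]
        (ℱ : Filtration ℕ mΩ)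
        (S : RDEG n m M Ξ) (F : Vec n → Vec m → Ξ → ℝ)
        (Gx : Vec n → Vec m → Vec n) (Gy : Vec n → Vec m → Vec m)
        (σx : Fin n → ℝ) (σy : Fin m → ℝ) (L : ℝ) (xs : Vec n) (ys : Vec m)
        (ξ : ℕ → Fin M → Ω → Ξ) (ax : ℕ → Fin M → Ω → Vec n) (ay : ℕ → Fin M → Ω → Vec m),
        -- the min-max problem
        Convex ℝ S.X → IsCompact S.X → Convex ℝ S.Y → IsCompact S.Y →
        (∀ x ∈ S.X, ∀ y ∈ S.Y, Integrable (F x y) 𝒟) →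
        IsPartialGradient S.X S.Y (population 𝒟 F) Gx Gy →
        IsConvexConcave S.X S.Y (population 𝒟 F) →
        IsSaddlePoint S.X S.Y (population 𝒟 F) xs ys →
        0 < L → IsSmooth S.X S.Y L Gx Gy →
        -- the stochastic oracle, the samples and the adversary
        IsOracle 𝒟 S.X S.Y Gx Gy S.gx S.gy σx σy →
        IsByzantineModel P ℱ 𝒟 S.B (2 * T) ξ ax ay →
        -- the number of agents and the corruption fraction
        Even M → (S.B.card : ℝ) ≤ S.α * M → 0 ≤ S.α → S.α < 1 / 16 →
        48 * Real.log (16 * (max n m : ℕ) * (T : ℝ) ^ 2) ≤ M →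
        -- the parameters of the algorithm
        0 < T → S.x₁ ∈ S.X → S.y₁ ∈ S.Y → 0 < S.η → S.η ≤ 1 / (2 * L) →
        S.δ = 1 / (4 * (max n m : ℕ) * (T : ℝ) ^ 2) →
        -- the lower trimming quantile does not exceed the upper one
        trimLevel S.α S.δ M ≤ 1 / 2 →
        ENNReal.ofReal (1 - 1 / (T : ℝ)) ≤
          P {ω | |population 𝒟 F
                    (S.average (fun k i => ξ k i ω) (fun k i => ax k i ω) (fun k i => ay k i ω) T).1
                    (S.average (fun k i => ξ k i ω) (fun k i => ax k i ω) (fun k i => ay k i ω) T).2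
                  - population 𝒟 F xs ys|
              ≤ max (Metric.diam S.X) (Metric.diam S.Y) ^ 2 / (S.η * T)
                + C * (noiseLevel σx σy * max (Metric.diam S.X) (Metric.diam S.Y)
                  * (Real.sqrt S.α
                    + Real.sqrt (Real.log (4 * (max n m : ℕ) * (T : ℝ) ^ 2) / M)))} := by
  -- `2856 = 6 * 68 * 7`: extra-gradient, trimmed mean, and the bound on `√ε`.
  refine ⟨2856, by norm_num, ?_⟩
  intro n m M T Ξ _ 𝒟 _ Ω mΩ P _ ℱ S F Gx Gy σx σy L xs ys ξ ax ay hXc hX hYc hY _ hG hf hs hL hsm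
    hO hBm hM hBα hα _ hMlog hT hx₁ hy₁ hη hηL hδ hε
  set D := max (Metric.diam S.X) (Metric.diam S.Y)
  have hT' : (0 : ℝ) < T := by exact_mod_cast hT
  have hD0 : 0 ≤ D := Metric.diam_nonneg.trans (le_max_left _ _)
  have hσ0 : 0 ≤ noiseLevel σx σy := (Real.sqrt_nonneg _).trans (le_max_left _ _)
  rcases Nat.eq_zero_or_pos (max n m) with hd | hd
  -- In dimension zero the logarithmic condition on `M` is void, but both spaces are single points
  -- and the error is zero.
  · obtain rfl : n = 0 := by omega
    obtain rfl : m = 0 := by omega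
    refine (ENNReal.ofReal_le_one.2 (by linarith [one_div_pos.2 hT'])).trans ?_
    rw [← measure_univ (μ := P)]
    refine measure_mono fun ω _ => ?_
    have h1 : ∀ x : Vec 0, x = xs := fun x => Subsingleton.elim _ _
    have h2 : ∀ y : Vec 0, y = ys := fun y => Subsingleton.elim _ _
    rw [Set.mem_ofPred_eq]
    rw [h1 (S.average _ _ _ T).1, h2 (S.average _ _ _ T).2, sub_self, abs_zero]
    positivity
  have hM0 : 0 < M := by
    have h1 : (1 : ℝ) ≤ (max n m : ℕ) := by exact_mod_cast hd
    have h2 : (1 : ℝ) ≤ (T : ℝ) ^ 2 := one_le_pow₀ (by exact_mod_cast hT)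
    have h3 : 0 < Real.log (16 * (max n m : ℕ) * (T : ℝ) ^ 2) := Real.log_pos (by nlinarith)
    have : (0 : ℝ) < M := by linarith
    exact_mod_cast this
  obtain ⟨hε0, hεα, hεδ, hεsqrt⟩ := trimLevel_bounds hd hT hM hM0 hα hδ
  have hB : (S.B.card : ℝ) ≤ trimLevel S.α S.δ M * (M / 2 : ℕ) / 4 := by
    have hMN : (M : ℝ) = 2 * (M / 2 : ℕ) := by
      obtain ⟨r, hr⟩ := hM
      have : M = 2 * (M / 2) := by omega
      exact_mod_cast this
    have : 8 * S.α * (M / 2 : ℕ) ≤ trimLevel S.α S.δ M * (M / 2 : ℕ) := by gcongr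
    rw [hMN] at hBα
    linarith
  set e := 68 * Real.sqrt (trimLevel S.α S.δ M) * noiseLevel σx σy
  set z : ℕ → Ω → Vec n × Vec m := fun t ω =>
    S.iter (fun k i => ξ k i ω) (fun k i => ax k i ω) (fun k i => ay k i ω) t
  set w : ℕ → Ω → Vec n × Vec m := fun t ω =>
    S.midIter (fun k i => ξ k i ω) (fun k i => ax k i ω) (fun k i => ay k i ω) t
  have hmeas := S.measurable_iter hXc hX ⟨_, hx₁⟩ hYc hY ⟨_, hy₁⟩ hO.measurable_x hO.measurable_y
    hBm
  set acc : ℕ → (Ω → Vec n × Vec m) → Ω → Prop := fun k v ω =>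
    ‖S.robustX (v ω) (fun i => ξ k i ω) (fun i => ax k i ω) - Gx (v ω).1 (v ω).2‖ ≤ e ∧
      ‖S.robustY (v ω) (fun i => ξ k i ω) (fun i => ay k i ω) - Gy (v ω).1 (v ω).2‖ ≤ e
  set bad : Set Ω := ⋃ t ∈ Finset.range T,
    ({ω | ¬ acc (2 * t) (z t) ω} ∪ {ω | ¬ acc (2 * t + 1) (w t) ω})
  have hbad : P bad ≤ ENNReal.ofReal (1 / T) := by
    refine (measure_biUnion_finset_le _ _).trans ?_
    have hphase : ∀ t ∈ Finset.range T, P ({ω | ¬ acc (2 * t) (z t) ω} ∪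
        {ω | ¬ acc (2 * t + 1) (w t) ω}) ≤ ENNReal.ofReal (1 / (T : ℝ) ^ 2) := by
      intro t ht
      have ht := Finset.mem_range.1 ht
      have h1 := measure_phase_error_le S hO hBm hM hM0 hε0 hε hB hεδ (k := 2 * t) (by omega)
        (w := z t) ((hmeas t).1 (by omega)) (fun ω => S.iter_mem hX hY hx₁ hy₁ _ _ _ t) le_rfl
      have h2 := measure_phase_error_le S hO hBm hM hM0 hε0 hε hB hεδ (k := 2 * t + 1) (by omega)
        (w := w t) ((hmeas t).2 (by omega)) (fun ω => S.midIter_mem hX hY hx₁ hy₁ _ _ _ t) le_rfl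
      refine (measure_union_le _ _).trans ((add_le_add h1 h2).trans ?_)
      have hnm : ((n + m : ℕ) : ℝ) ≤ 2 * (max n m : ℕ) := by
        exact_mod_cast (by omega : n + m ≤ 2 * max n m)
      have hδ0 : 0 ≤ S.δ := by rw [hδ]; positivity
      have hcast : (n + m : ENNReal) * ENNReal.ofReal S.δ
          = ENNReal.ofReal ((n + m : ℕ) * S.δ) := by
        rw [ENNReal.ofReal_mul (by positivity), ENNReal.ofReal_natCast, Nat.cast_add]
      rw [hcast, ← ENNReal.ofReal_add (by positivity) (by positivity)]
      refine ENNReal.ofReal_le_ofReal ?_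
      have h3 : ((n + m : ℕ) : ℝ) * S.δ ≤ 2 * (max n m : ℕ) * S.δ :=
        mul_le_mul_of_nonneg_right hnm hδ0
      have hd' : (0 : ℝ) < (max n m : ℕ) := by exact_mod_cast hd
      -- Each of the two phases of a round fails with probability at most `2 d δ = 1 / (2 T ^ 2)`.
      have h4 : 2 * ((max n m : ℕ) : ℝ) * S.δ = 1 / (T : ℝ) ^ 2 / 2 := by
        rw [hδ]; field_simp; norm_num
      linarith
    refine (Finset.sum_le_sum hphase).trans ?_
    rw [Finset.sum_const, Finset.card_range, ← ENNReal.ofReal_nsmul, nsmul_eq_mul]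
    refine ENNReal.ofReal_le_ofReal (le_of_eq ?_)
    field_simp
  rw [ENNReal.ofReal_sub _ (by positivity), ENNReal.ofReal_one]
  -- The target event and `bad` cover the whole space, so subadditivity suffices and the target
  -- event need not be measurable.
  refine tsub_le_iff_right.2 ?_
  rw [← measure_univ (μ := P)]
  refine le_trans (measure_mono ?_) ((measure_union_le _ bad).trans (add_le_add le_rfl hbad))
  intro ω _
  by_cases hω : ω ∈ bad
  · exact Or.inr hω
  refine Or.inl ?_
  have hgood : ∀ t < T, acc (2 * t) (z t) ω ∧ acc (2 * t + 1) (w t) ω := by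
    intro t ht
    by_contra hc
    refine hω (Set.mem_biUnion (Finset.mem_coe.2 (Finset.mem_range.2 ht)) ?_)
    exact not_and_or.1 hc
  refine (S.abs_average_sub_le hXc hX hYc hY hG hf hs hL hsm hx₁ hy₁ hη hηL hT _ _ _
    hgood).trans (add_le_add le_rfl ?_)
  have h1 := mul_le_mul_of_nonneg_left hεsqrt (mul_nonneg hσ0 hD0)
  calc 6 * e * D = 408 * (noiseLevel σx σy * D * Real.sqrt (trimLevel S.α S.δ M)) := by
        simp only [e]; ring
    _ ≤ 408 * (noiseLevel σx σy * D * (7 * (Real.sqrt S.α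
          + Real.sqrt (Real.log (4 * (max n m : ℕ) * (T : ℝ) ^ 2) / M)))) := by gcongr
    _ = _ := by ring
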